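/- Let $n\ge 2$, let $\mathfrak{gl}_n$ be the Lie algebra of complex $n\times n$ matrices with matrix units $E_{ij}$, let $U_m=U(\mathfrak{gl}_m)\subseteq U=U(\mathfrak{gl}_n)$ be generated by the $E_{ij}$ with $i,j\le m$, and let $\Gamma\subseteq U$ be the Gelfand–Tsetlin subalgebra, generated by the centers of $U_1,\dots,U_n$. A tableau $T(L)$ is an array $L=(l_{ij})_{1\le j\le i\le n}$ of complex numbers; $T(L)$ is noncritical if $l_{ki}\ne l_{kj}$ whenever $i\neq j$ and $k\le n-1$. It satisfies the relation $(i,j)\ge(s,t)$ (respectively $(i,j)>(s,t)$) if $l_{ij}-l_{st}\in\mathbb Z_{\ge 0}$ (respectively $\mathbb Z_{>0}$). Let $\mathcal C$ be a subset of $\mathcal R\cup\mathcal R^0$, where $$\mathcal R=\{(i,j)\ge(i-1,j'),\ (i-1,j')>(i,j)\mid 1\le j\le i\le n,\ 1\le j'\le i-1\},\qquad \mathcal R^0=\{(n,i)\ge(n,j)\mid 1\le i\ne j\le n\}.$$ Two sets of relations are disconnected if no position is involved in both; $\mathcal C$ is uniquely a union of pairwise disconnected nonempty indecomposable sets, its components.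 A tableau $T(L)$ is a $\mathcal C$-realization if it satisfies all relations of $\mathcal C$ and, for all $k\le n$ and $i\ne j$, $l_{ki}-l_{kj}\in\mathbb Z$ if and only if $(k,i)$ and $(k,j)$ are both involved in the same component of $\mathcal C$. Let $\mathcal B_{\mathcal C}(T(L))$ be the set of all tableaux $T(L+z)$ satisfying $\mathcal C$, where $z$ is an integral array with zero top row, and let $V_{\mathcal C}(T(L))$ be the complex vector space with basis $\mathcal B_{\mathcal C}(T(L))$. The set $\mathcal C$ is admissible if for every $\mathcal C$-realization $T(L)$ all tableaux in $\mathcal B_{\mathcal C}(T(L))$ are noncritical and $V_{\mathcal C}(T(L))$ is a $\mathfrak{gl}_n$-module by the Gelfand–Tsetlin formulas $$E_{k,k+1}T(R)=-\sum_{i=1}^{k}\frac{\prod_{j=1}^{k+1}(r_{ki}-r_{k+1,j})}{\prod_{j\ne i}(r_{ki}-r_{kj})}\,T(R+\delta^{ki}),\qquad E_{k+1,k}T(R)=\sum_{i=1}^{k}\frac{\prod_{j=1}^{k-1}(r_{ki}-r_{k-1,j})}{\prod_{j\ne i}(r_{ki}-r_{kj})}\,T(R-\delta^{ki}),$$ $$E_{kk}T(R)=\Bigl(k-1+\sum_{i=1}^{k}r_{ki}-\sum_{i=1}^{k-1}r_{k-1,i}\Bigr)T(R),$$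 where $\delta^{ki}$ is the array with $1$ at $(k,i)$ and $0$ elsewhere, and $T(R\pm\delta^{ki})$ is read as $0$ if it is not in $\mathcal B_{\mathcal C}(T(L))$. Theorem. Let $\mathcal C\subseteq\mathcal R\cup\mathcal R^0$ be admissible, let $T(L)$ be a $\mathcal C$-realization, and let $M=V_{\mathcal C}(T(L))$ with this module structure. For a maximal ideal $\mathfrak m$ of $\Gamma$ put $M(\mathfrak m)=\{v\in M\mid \mathfrak m^k v=0\text{ for some }k\ge 0\}$. Then for every maximal ideal $\mathfrak m$ of $\Gamma$ in the Gelfand–Tsetlin support of $M$, that is, with $M(\mathfrak m)\ne 0$, the Gelfand–Tsetlin multiplicity of $\mathfrak m$ is one: $\dim_{\mathbb C}M(\mathfrak m)=1$. -/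

import Mathlib

namespace GelfandTsetlin

-- Matrices, endomorphisms and other associative algebras are Lie algebras by the commutator.
attribute [local instance 100] LieRing.ofAssociativeRing

/-- Positions of a triangular array of height `n`.  The first component `k : Fin n` encodes the row
`k + 1`, which has `k + 1` entries. -/
abbrev Pos (n : ℕ) : Type := Σ k : Fin n, Fin ((k : ℕ) + 1)

/-- The row number of a position, counted from `1` (bottom row, one entry) to `n` (top row). -/
def Pos.row {n : ℕ} (p : Pos n) : ℕ := (p.1 : ℕ) + 1

/-- The positions of the `k`-th row (empty unless `1 ≤ k ≤ n`). -/
def rowSet (n k : ℕ) : Finset (Pos n) := Finset.univ.filter fun p => p.row = k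

/-- Gelfand-Tsetlin tableaux of height `n` with complex entries. -/
abbrev Tableau (n : ℕ) : Type := Pos n → ℂ

/-! ### Sets of relations -/

/-- Formal relations `p ≥ q` and `p > q` between positions. -/
inductive Rel (n : ℕ) : Type
  | ge (p q : Pos n) : Rel n
  | gt (p q : Pos n) : Rel n

/-- The positions that a relation involves. -/
def Rel.positions {n : ℕ} : Rel n → Set (Pos n)
  | .ge p q => {p, q}
  | .gt p q => {p, q}

/-- `T(L)` satisfies `p ≥ q` if `l_p - l_q ∈ ℤ_{≥ 0}`, and `p > q` if `l_p - l_q ∈ ℤ_{> 0}`. -/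
def Rel.Holds {n : ℕ} (L : Tableau n) : Rel n → Prop
  | .ge p q => ∃ m : ℤ, 0 ≤ m ∧ L p - L q = (m : ℂ)
  | .gt p q => ∃ m : ℤ, 0 < m ∧ L p - L q = (m : ℂ)

/-- The set `ℛ`: relations `(i, j) ≥ (i - 1, j')` and `(i - 1, j') > (i, j)`. -/
def relR (n : ℕ) : Set (Rel n) :=
  {r | ∃ p q : Pos n, p.row = q.row + 1 ∧ (r = .ge p q ∨ r = .gt q p)}

/-- The set `ℛ⁰`: relations `(n, i) ≥ (n, j)`, `i ≠ j`, in the top row. -/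
def relR0 (n : ℕ) : Set (Rel n) :=
  {r | ∃ p q : Pos n, p.row = n ∧ q.row = n ∧ p ≠ q ∧ r = .ge p q}

/-- The set `𝔙(C)` of positions involved in the relations of `C`. -/
def involved {n : ℕ} (C : Set (Rel n)) : Set (Pos n) := {p | ∃ r ∈ C, p ∈ r.positions}

/-- Two sets of relations are disconnected if they involve no common position. -/
def Disconnected {n : ℕ} (C₁ C₂ : Set (Rel n)) : Prop := Disjoint (involved C₁) (involved C₂)

/-- A set of relations is indecomposable if it is not the union of two nonempty disconnected
sets. -/
def Indecomposable {n : ℕ} (C : Set (Rel n)) : Prop :=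
  ¬ ∃ C₁ C₂ : Set (Rel n), C₁.Nonempty ∧ C₂.Nonempty ∧ Disconnected C₁ C₂ ∧ C = C₁ ∪ C₂

/-- `D` is one of the sets in the decomposition of `C` into disconnected (nonempty) indecomposable
sets. -/
def IsComponent {n : ℕ} (C D : Set (Rel n)) : Prop :=
  D ⊆ C ∧ D.Nonempty ∧ Indecomposable D ∧ Disconnected D (C \ D)

/-- `T(L)` satisfies all the relations in `C`. -/
def Satisfies {n : ℕ} (C : Set (Rel n)) (L : Tableau n) : Prop := ∀ r ∈ C, r.Holds L

/-- `T(L)` is a `C`-realization: it satisfies `C`, and two distinct entries of one row differ by an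
integer if and only if their positions are involved in the same indecomposable component of `C`. -/
def IsRealization {n : ℕ} (C : Set (Rel n)) (L : Tableau n) : Prop :=
  Satisfies C L ∧
    ∀ p q : Pos n, p.row = q.row → p ≠ q →
      ((∃ m : ℤ, L p - L q = (m : ℂ)) ↔ ∃ D, IsComponent C D ∧ p ∈ involved D ∧ q ∈ involved D)

/-- A tableau is noncritical if the entries in each row below the top row are distinct. -/
def Noncritical {n : ℕ} (L : Tableau n) : Prop :=
  ∀ p q : Pos n, p.row = q.row → p.row < n → p ≠ q → L p ≠ L q

/-! ### The space `V_C(T(L))` and the Gelfand-Tsetlin formulas -/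

/-- The set `ℬ_C(T(L))` of all tableaux `T(L + z)` satisfying `C`, where `z` is an integral array
whose top row is zero. -/
def tableaux {n : ℕ} (C : Set (Rel n)) (L : Tableau n) : Set (Tableau n) :=
  {R | (∃ z : Pos n → ℤ, (∀ p, p.row = n → z p = 0) ∧ ∀ p, R p = L p + (z p : ℂ)) ∧
    Satisfies C R}

/-- The complex vector space `V_C(T(L))` with basis `ℬ_C(T(L))`. -/
abbrev TabSpace {n : ℕ} (C : Set (Rel n)) (L : Tableau n) : Type := tableaux C L →₀ ℂ

open Classical in
/-- The vector `T(R)` of `V_C(T(L))`: a basis vector if `R` belongs to `ℬ_C(T(L))`, and zero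
otherwise. -/
noncomputable def tab {n : ℕ} (C : Set (Rel n)) (L R : Tableau n) : TabSpace C L :=
  if h : R ∈ tableaux C L then Finsupp.single ⟨R, h⟩ 1 else 0

/-- The array `δ^p` with entry `1` at `p` and `0` elsewhere. -/
def delta {n : ℕ} (p : Pos n) : Tableau n := Pi.single p 1

/-- The matrix unit `E_{ij}` of `𝔤𝔩_n`, with `i` and `j` counted from `1`. -/
def matUnit (n i j : ℕ) : Matrix (Fin n) (Fin n) ℂ :=
  Matrix.of fun a b => if (a : ℕ) + 1 = i ∧ (b : ℕ) + 1 = j then 1 else 0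

/-- The coefficient of `T(L + δ^{ki})` in `E_{k,k+1} T(L)`, where `p = (k, i)`. -/
noncomputable def raiseCoeff {n : ℕ} (L : Tableau n) (p : Pos n) : ℂ :=
  -((∏ q ∈ rowSet n (p.row + 1), (L p - L q)) / ∏ q ∈ (rowSet n p.row).erase p, (L p - L q))

/-- The coefficient of `T(L - δ^{ki})` in `E_{k+1,k} T(L)`, where `p = (k, i)`. -/
noncomputable def lowerCoeff {n : ℕ} (L : Tableau n) (p : Pos n) : ℂ :=
  (∏ q ∈ rowSet n (p.row - 1), (L p - L q)) / ∏ q ∈ (rowSet n p.row).erase p, (L p - L q)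

/-- Structures of a `𝔤𝔩_n`-module on the space `V_C(T(L))`. -/
abbrev GLAction {n : ℕ} (C : Set (Rel n)) (L : Tableau n) : Type :=
  Matrix (Fin n) (Fin n) ℂ →ₗ⁅ℂ⁆ Module.End ℂ (TabSpace C L)

/-- The module structure `ρ` on `V_C(T(L))` is given by the Gelfand-Tsetlin formulas.  All tableaux
of `ℬ_C(T(L))` have to be noncritical, since otherwise the formulas are not defined. -/
structure IsGTAction {n : ℕ} (C : Set (Rel n)) (L : Tableau n) (ρ : GLAction C L) : Prop where
  noncritical : ∀ R ∈ tableaux C L, Noncritical R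
  raise : ∀ R ∈ tableaux C L, ∀ k, 1 ≤ k → k < n →
    ρ (matUnit n k (k + 1)) (tab C L R) =
      ∑ p ∈ rowSet n k, raiseCoeff R p • tab C L (R + delta p)
  lower : ∀ R ∈ tableaux C L, ∀ k, 1 ≤ k → k < n →
    ρ (matUnit n (k + 1) k) (tab C L R) =
      ∑ p ∈ rowSet n k, lowerCoeff R p • tab C L (R - delta p)
  diag : ∀ R ∈ tableaux C L, ∀ k, 1 ≤ k → k ≤ n →
    ρ (matUnit n k k) (tab C L R) =
      ((k : ℂ) - 1 + ∑ p ∈ rowSet n k, R p - ∑ p ∈ rowSet n (k - 1), R p) • tab C L R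

/-- A set `C ⊆ ℛ ∪ ℛ⁰` is admissible if for every `C`-realization `T(L)` the space `V_C(T(L))` is a
`𝔤𝔩_n`-module by the Gelfand-Tsetlin formulas. -/
def Admissible {n : ℕ} (C : Set (Rel n)) : Prop :=
  C ⊆ relR n ∪ relR0 n ∧ ∀ L : Tableau n, IsRealization C L → ∃ ρ : GLAction C L, IsGTAction C L ρ

/-! ### The Gelfand-Tsetlin subalgebra -/

/-- The universal enveloping algebra `U(𝔤𝔩_n)`. -/
abbrev U (n : ℕ) : Type := UniversalEnvelopingAlgebra ℂ (Matrix (Fin n) (Fin n) ℂ)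

/-- The subalgebra `U_m = U(𝔤𝔩_m)` of `U(𝔤𝔩_n)`, generated by the `E_{ij}` with `i, j ≤ m`. -/
noncomputable def subU (n m : ℕ) : Subalgebra ℂ (U n) :=
  Algebra.adjoin ℂ {x | ∃ i j : ℕ, 1 ≤ i ∧ i ≤ m ∧ 1 ≤ j ∧ j ≤ m ∧
    x = UniversalEnvelopingAlgebra.ι ℂ (matUnit n i j)}

/-- The center `Z_m` of `U_m`, as a subset of `U(𝔤𝔩_n)`. -/
def centerU (n m : ℕ) : Set (U n) := {x | x ∈ subU n m ∧ ∀ y ∈ subU n m, x * y = y * x}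

/-- The Gelfand-Tsetlin subalgebra `Γ`, generated by `Z_1, …, Z_n`. -/
noncomputable def Gam (n : ℕ) : Subalgebra ℂ (U n) :=
  Algebra.adjoin ℂ {x | ∃ m, 1 ≤ m ∧ m ≤ n ∧ x ∈ centerU n m}

theorem subU_mono (n : ℕ) {m m' : ℕ} (h : m ≤ m') : subU n m ≤ subU n m' := by
  apply Algebra.adjoin_mono
  rintro x ⟨i, j, hi, hi', hj, hj', rfl⟩
  exact ⟨i, j, hi, hi'.trans h, hj, hj'.trans h, rfl⟩

theorem centerU_comm (n : ℕ) {m m' : ℕ} {x y : U n} (hx : x ∈ centerU n m)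
    (hy : y ∈ centerU n m') : x * y = y * x := by
  rcases le_total m m' with h | h
  · exact (hy.2 x (subU_mono n h hx.1)).symm
  · exact hx.2 y (subU_mono n h hy.1)

/-- The Gelfand-Tsetlin subalgebra is commutative. -/
instance instIsMulCommutativeGam (n : ℕ) : IsMulCommutative (Gam n) :=
  Algebra.isMulCommutative_adjoin ℂ (by
    rintro x ⟨m, -, -, hx⟩ y ⟨m', -, -, hy⟩
    exact centerU_comm n hx hy)

/-- The subspace `M(𝔪) = {v | 𝔪 ^ k v = 0 for some k}` of `M = V_C(T(L))` for an ideal `𝔪` of `Γ`;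
its dimension is the Gelfand-Tsetlin multiplicity of `𝔪`. -/
def gtSpace {n : ℕ} {C : Set (Rel n)} {L : Tableau n} (ρ : GLAction C L) (𝔪 : Ideal (Gam n)) :
    Submodule ℂ (TabSpace C L) where
  carrier := {v | ∃ k : ℕ, ∀ x ∈ 𝔪 ^ k, UniversalEnvelopingAlgebra.lift ℂ ρ (x : U n) v = 0}
  zero_mem' := ⟨0, fun x _ => map_zero _⟩
  add_mem' := by
    rintro v w ⟨k, hk⟩ ⟨l, hl⟩
    refine ⟨max k l, fun x hx => ?_⟩
    rw [map_add, hk x (Ideal.pow_le_pow_right (le_max_left k l) hx),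
      hl x (Ideal.pow_le_pow_right (le_max_right k l) hx), add_zero]
  smul_mem' := by
    rintro c v ⟨k, hk⟩
    exact ⟨k, fun x hx => by rw [map_smul, hk x hx, smul_zero]⟩

/-- The Gelfand-Tsetlin support of `V_C(T(L))`: the maximal ideals `𝔪` of `Γ` with `M(𝔪) ≠ 0`. -/
def gtSupport {n : ℕ} {C : Set (Rel n)} {L : Tableau n} (ρ : GLAction C L) :
    Set (Ideal (Gam n)) :=
  {𝔪 | 𝔪.IsMaximal ∧ gtSpace ρ 𝔪 ≠ ⊥}

end GelfandTsetlin

/-! # Gelfand-Tsetlin multiplicities of relation modules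

The resolvents `(u - E)⁻¹` of the blocks of the matrix `E` of matrix units are built by induction on
the size of the block, and their traces turn out to be diagonal in the basis of tableaux. As the
resolvents decay for large `u`, so are the traces of the powers of `E`, and their eigenvalues
determine the rows of a tableau up to order. Combined with the relations this separates tableaux, so
that the Gelfand-Tsetlin subalgebra acts diagonally with pairwise distinct characters. -/

/-! It suffices that `Γ` acts diagonally on tableaux with pairwise distinct characters: a vector
killed by a power of a maximal ideal `𝔪` is then supported on tableaux whose character has kernel
`𝔪`, and there is only one.

The elements of `Γ` that are used are the traces of the powers of `E_N`, the top left `N × N` block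
of the matrix of generators. They are reached through the resolvent `t(u) = (u - E_N)⁻¹`. Block
inversion passes from `N` to `N + 1` once the Schur complement `S` is known. A commutator of a
raising operator with `E_{N+1,N}` expresses `S`, and its value on a tableau follows from a partial
fraction identity (`nbrPoly_eq_partialFrac`) for the polynomial built from the two neighbouring
rows. Then `1 - tr t(u)` acts on `T(R)` by `A(u - N) / A(u - N + 1)`, where the roots of `A` are the
entries of row `N` (`one_sub_trace_resolv`).

The delicate point is the partial fraction identity when two entries of a row differ by one: two
nodes collide, and the polynomial must have a double root there. The residues show only a simple
root. The missing condition is the sum rule from `[E_{k,k+1}, E_{k+1,k}] = E_{kk} - E_{k+1,k+1}`. It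
suffices for a single collision, and the general case is deformed to that one: admissibility speaks
of all realizations, so the other entries can be moved apart along the order generated by `C`
(`IsRealization.sq_dvd_nbrPoly`).

Since `t(u + j)` tends to zero and `E t = u t - 1`, the traces of powers are diagonal
(`blockTrace_tab`), and their eigenvalues determine every row up to order (`rowPoly_eq`). In a row
below the top one, the relation "differs by a nonnegative integer" between positions is dictated by
`C` alone, so unordered rows determine the tableau (`eq_of_rowPoly_eq`). The rest of `Γ` commutes
with the traces and is therefore diagonal too. -/

namespace GelfandTsetlin

open Finset

/-! ### Resolvents of the matrix of generators over a noncommutative algebra -/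

section Resolvent

variable {A : Type*} [Ring A] [Algebra ℂ A]

/-- The commutation relations of the matrix units of `𝔤𝔩_n`, for elements of an algebra. -/
def GLRel (n : ℕ) (e : ℕ → ℕ → A) : Prop :=
  ∀ i j k l, i < n → j < n → k < n → l < n →
    e i j * e k l - e k l * e i j = (if j = k then e i l else 0) - (if l = i then e k j else 0)

/-- `t` is the inverse of the matrix `u - E`, where `E` is the top left `N × N` block of `e`. -/
structure IsResolvent (e : ℕ → ℕ → A) (N : ℕ) (u : ℂ) (t : ℕ → ℕ → A) : Prop where
  left : ∀ i < N, ∀ j < N, ∑ k ∈ range N, e i k * t k j = u • t i j - if i = j then 1 else 0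
  right : ∀ i < N, ∀ j < N, ∑ k ∈ range N, t i k * e k j = u • t i j - if i = j then 1 else 0

/-- The product of the matrix `t` and the column `X`. -/
def mulCol (N : ℕ) (t : ℕ → ℕ → A) (X : ℕ → A) (a : ℕ) : A := ∑ i ∈ range N, t a i * X i

/-- The product of the row `Y` and the matrix `t`. -/
def rowMul (N : ℕ) (t : ℕ → ℕ → A) (Y : ℕ → A) (b : ℕ) : A := ∑ i ∈ range N, Y i * t i b

/-- The Schur complement of `u - E` in the next larger block. -/
def schur (e : ℕ → ℕ → A) (N : ℕ) (u : ℂ) (t : ℕ → ℕ → A) : A :=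
  u • 1 - e N N - ∑ i ∈ range N, e N i * mulCol N t (fun i => e i N) i

/-- A column that transforms under the matrix units like the standard basis. -/
def IsVectorOp (e : ℕ → ℕ → A) (N : ℕ) (X : ℕ → A) : Prop :=
  ∀ i < N, ∀ j < N, ∀ k < N, e i j * X k - X k * e i j = if j = k then X i else 0

variable {n N : ℕ} {e t t₁ : ℕ → ℕ → A} {u : ℂ} {X : ℕ → A}

/-- The noncommutative form of `[a⁻¹, y] = a⁻¹ [y, a] a⁻¹` for `a = u - E`: the scalar `u` drops out
of the commutator. -/
theorem IsResolvent.commutator (h : IsResolvent e N u t) (y : A) {a b : ℕ} (ha : a < N)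
    (hb : b < N) :
    t a b * y - y * t a b =
      ∑ i ∈ range N, ∑ j ∈ range N, t a i * (e i j * y - y * e i j) * t j b := by
  have h1 : ∑ i ∈ range N, ∑ j ∈ range N, t a i * e i j * (y * t j b)
      = u • ∑ j ∈ range N, t a j * (y * t j b) - y * t a b := by
    rw [sum_comm]
    simp_rw [← sum_mul]
    rw [sum_congr rfl (g := fun j => u • (t a j * (y * t j b)) -
      (if a = j then y * t j b else 0)), sum_sub_distrib, sum_ite_eq, smul_sum]
    · simp [ha]
    · intro j hj
      rw [h.right a ha j (mem_range.1 hj), sub_mul, smul_mul_assoc]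
      split_ifs <;> simp
  have h2 : ∑ i ∈ range N, ∑ j ∈ range N, t a i * y * (e i j * t j b)
      = u • ∑ j ∈ range N, t a j * (y * t j b) - t a b * y := by
    simp_rw [← mul_sum]
    rw [sum_congr rfl (g := fun j => u • (t a j * (y * t j b)) -
      (if j = b then t a j * y else 0)), sum_sub_distrib, sum_ite_eq', smul_sum]
    · simp [hb]
    · intro j hj
      rw [h.left j (mem_range.1 hj) b hb, mul_sub, mul_smul_comm, mul_assoc]
      split_ifs <;> simp
  have h3 : ∀ i j, t a i * (e i j * y - y * e i j) * t j b
      = t a i * e i j * (y * t j b) - t a i * y * (e i j * t j b) := by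
    intro i j; noncomm_ring
  simp_rw [h3, sum_sub_distrib, h1, h2]
  abel

theorem IsResolvent.comm_of_comm (h : IsResolvent e N u t) {y : A}
    (hy : ∀ i < N, ∀ j < N, e i j * y = y * e i j) {a b : ℕ} (ha : a < N) (hb : b < N) :
    t a b * y = y * t a b := by
  rw [← sub_eq_zero, h.commutator y ha hb]
  refine sum_eq_zero fun i hi => sum_eq_zero fun j hj => ?_
  rw [hy i (mem_range.1 hi) j (mem_range.1 hj)]
  simp

/-- When `t a b` is a known diagonal operator with nonzero eigenvalues, this determines the product
`tX` from `X`; `isRaising_mulCol` uses it so. -/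
theorem IsResolvent.comm_vectorOp (h : IsResolvent e N u t) (hX : IsVectorOp e N X) {a b k : ℕ}
    (ha : a < N) (hb : b < N) (hk : k < N) :
    t a b * X k - X k * t a b = mulCol N t X a * t k b := by
  rw [h.commutator (X k) ha hb, mulCol, sum_mul]
  refine sum_congr rfl fun i hi => ?_
  rw [sum_congr rfl (g := fun j => if k = j then t a i * X i * t j b else 0), sum_ite_eq]
  · simp [hk]
  · intro j hj
    rw [hX i (mem_range.1 hi) j (mem_range.1 hj) k hk]
    by_cases hjk : j = k
    · simp [hjk]
    · simp [hjk, Ne.symm hjk]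

/-- The resolvent transforms under `𝔤𝔩_N` in the same way as the matrix `E` itself. -/
theorem IsResolvent.comm_unit (h : IsResolvent e N u t) (he : GLRel n e) (hN : N ≤ n)
    {a b k l : ℕ} (ha : a < N) (hb : b < N) (hk : k < N) (hl : l < N) :
    e k l * t a b - t a b * e k l = (if l = a then t k b else 0) - if k = b then t a l else 0 := by
  have key := h.commutator (e k l) ha hb
  have h1 : ∀ i ∈ range N, ∑ j ∈ range N, t a i * (e i j * e k l - e k l * e i j) * t j b =
      t a i * e i l * t k b - if l = i then t a i * ∑ j ∈ range N, e k j * t j b else 0 := by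
    intro i hi
    rw [sum_congr rfl (g := fun j => (if k = j then t a i * e i l * t j b else 0) -
      (if l = i then t a i * (e k j * t j b) else 0)), sum_sub_distrib, sum_ite_eq]
    · rw [if_pos (mem_range.2 hk)]
      split_ifs <;> simp [mul_sum]
    · intro j hj
      have hi' := (mem_range.1 hi).trans_le hN
      have hj' := (mem_range.1 hj).trans_le hN
      rw [he i j k l hi' hj' (hk.trans_le hN) (hl.trans_le hN)]
      simp only [eq_comm (a := k) (b := j)]
      by_cases h1 : j = k <;> by_cases h2 : l = i <;> simp [h1, h2, sub_mul, mul_sub, mul_assoc]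
  rw [sum_congr rfl h1, sum_sub_distrib, ← sum_mul, h.right a ha l hl, sum_ite_eq,
    if_pos (mem_range.2 hl), h.left k hk b hb] at key
  rw [← neg_sub, key, sub_mul, mul_sub]
  simp only [smul_mul_assoc, mul_smul_comm]
  by_cases h1 : a = l <;> by_cases h2 : k = b <;> simp [h1, h2, Ne.symm]

theorem IsResolvent.vectorOp (h : IsResolvent e N u t) (he : GLRel n e) (hN : N ≤ n)
    (hX : IsVectorOp e N X) : IsVectorOp e N (mulCol N t X) := by
  intro i hi j hj k hk
  have h1 : e i j * mulCol N t X k - mulCol N t X k * e i j =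
      ∑ l ∈ range N, ((if j = k then t i l * X l else 0) - (if i = l then t k j * X l else 0) +
        if j = l then t k l * X i else 0) := by
    rw [mulCol, mul_sum, sum_mul, ← sum_sub_distrib]
    refine sum_congr rfl fun l hl => ?_
    have h2 := h.comm_unit he hN hk (mem_range.1 hl) hi hj
    have h3 := hX i hi j hj l (mem_range.1 hl)
    calc e i j * (t k l * X l) - t k l * X l * e i j
        = (e i j * t k l - t k l * e i j) * X l + t k l * (e i j * X l - X l * e i j) := by
          noncomm_ring
      _ = _ := by
          rw [h2, h3]
          by_cases h4 : j = k <;> by_cases h5 : i = l <;> by_cases h6 : j = l <;>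
            simp [h4, h5, h6, sub_mul]
  rw [h1, sum_add_distrib, sum_sub_distrib, sum_ite_eq, sum_ite_eq, if_pos (mem_range.2 hi),
    if_pos (mem_range.2 hj)]
  split_ifs <;> simp [mulCol]

omit [Algebra ℂ A] in
theorem vectorOp_lastCol (he : GLRel n e) (hN : N < n) : IsVectorOp e N (fun i => e i N) := by
  intro i hi j hj k hk
  have := he i j k N (hi.trans hN) (hj.trans hN) (hk.trans hN) hN
  simpa [(show N ≠ i by omega)] using this

/-- The nontrivial term contracts the row `e N i`, which transforms dually, with a vector operator,
so it is invariant under `𝔤𝔩_N`. -/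
theorem IsResolvent.comm_schur (h : IsResolvent e N u t) (he : GLRel n e) (hN : N < n) {i j : ℕ}
    (hi : i < N) (hj : j < N) : e i j * schur e N u t = schur e N u t * e i j := by
  have hV := h.vectorOp he hN.le (vectorOp_lastCol he hN)
  set V := mulCol N t (fun i => e i N) with hVdef
  have h1 : e i j * e N N - e N N * e i j = 0 := by
    simpa [(show N ≠ i by omega), (show j ≠ N by omega)] using
      he i j N N (hi.trans hN) (hj.trans hN) hN hN
  have h2 : e i j * (∑ k ∈ range N, e N k * V k) - (∑ k ∈ range N, e N k * V k) * e i j = 0 := by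
    rw [mul_sum, sum_mul, ← sum_sub_distrib, sum_congr rfl (g := fun k =>
      (if j = k then e N k * V i else 0) - if i = k then e N j * V k else 0), sum_sub_distrib,
      sum_ite_eq, sum_ite_eq]
    · simp [hi, hj]
    · intro k hk
      have hk := mem_range.1 hk
      have h3 := he i j N k (hi.trans hN) (hj.trans hN) hN (hk.trans hN)
      have h4 := hV i hi j hj k hk
      have h7 : e i j * (e N k * V k) - e N k * V k * e i j =
          (e i j * e N k - e N k * e i j) * V k + e N k * (e i j * V k - V k * e i j) := by
        noncomm_ring
      rw [h7, h3, h4, if_neg (show j ≠ N by omega)]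
      by_cases h5 : j = k <;> by_cases h6 : i = k <;> simp [h5, h6, eq_comm]
  rw [sub_eq_zero] at h1 h2
  rw [schur, ← hVdef, mul_sub, mul_sub, sub_mul, sub_mul, h1, h2]
  simp

/-- This gives access to the Schur complement: for `a = k = N - 1` the left side is the commutator
of a raising operator with a Gelfand-Tsetlin generator, which can be computed on tableaux. -/
theorem IsResolvent.comm_col_row (h : IsResolvent e N u t) (he : GLRel n e) (hN : N < n) {a k : ℕ}
    (ha : a < N) (hk : k < N) :
    mulCol N t (fun i => e i N) a * e N k - e N k * mulCol N t (fun i => e i N) a =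
      t a k * schur e N u t - if a = k then 1 else 0 := by
  have hY : ∀ i < N, t a i * e N k - e N k * t a i = - (t a k * ∑ q ∈ range N, e N q * t q i) := by
    intro i hi
    rw [h.commutator _ ha hi, sum_congr rfl (g := fun p => if k = p then
      - (t a p * ∑ q ∈ range N, e N q * t q i) else 0), sum_ite_eq, if_pos (mem_range.2 hk)]
    intro p hp
    have hp := mem_range.1 hp
    have h1 : ∀ q ∈ range N, t a p * (e p q * e N k - e N k * e p q) * t q i =
        if k = p then - (t a p * (e N q * t q i)) else 0 := by
      intro q hq
      have hq := mem_range.1 hq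
      rw [he p q N k (hp.trans hN) (hq.trans hN) hN (hk.trans hN), if_neg (show q ≠ N by omega)]
      split_ifs <;> simp [mul_assoc]
    rw [sum_congr rfl h1]
    split_ifs <;> simp [mul_sum]
  have hX : ∀ i < N, e i N * e N k - e N k * e i N = e i k - if i = k then e N N else 0 := by
    intro i hi
    rw [he i N N k (hi.trans hN) hN hN (hk.trans hN), if_pos rfl]
    by_cases h1 : i = k <;> simp [h1, Ne.symm]
  have h1 : ∀ i ∈ range N, t a i * e i N * e N k - e N k * (t a i * e i N) =
      t a i * e i k - (if i = k then t a i * e N N else 0) -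
        (t a k * ∑ q ∈ range N, e N q * t q i) * e i N := by
    intro i hi
    have hi := mem_range.1 hi
    calc t a i * e i N * e N k - e N k * (t a i * e i N)
        = t a i * (e i N * e N k - e N k * e i N) + (t a i * e N k - e N k * t a i) * e i N := by
          noncomm_ring
      _ = _ := by
          rw [hX i hi, hY i hi]
          split_ifs <;> simp [mul_add, sub_eq_add_neg]
  have h2 : ∑ i ∈ range N, (t a k * ∑ q ∈ range N, e N q * t q i) * e i N =
      t a k * ∑ q ∈ range N, e N q * mulCol N t (fun i => e i N) q := by
    simp_rw [mulCol, mul_sum, sum_mul, mul_assoc]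
    exact sum_comm
  rw [mulCol, sum_mul, mul_sum, ← sum_sub_distrib, sum_congr rfl h1, sum_sub_distrib,
    sum_sub_distrib, h2, h.right a ha k hk, sum_ite_eq', if_pos (mem_range.2 hk), schur, mul_sub,
    mul_sub, mul_smul_comm, mul_one]
  abel

theorem IsResolvent.mul_mulCol (h : IsResolvent e N u t) (X : ℕ → A) {i : ℕ} (hi : i < N) :
    ∑ k ∈ range N, e i k * mulCol N t X k = u • mulCol N t X i - X i := by
  simp_rw [mulCol, mul_sum, smul_sum, ← mul_assoc]
  rw [sum_comm]
  simp_rw [← sum_mul]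
  rw [sum_congr rfl (g := fun j => u • (t i j * X j) - if i = j then X j else 0),
    sum_sub_distrib, sum_ite_eq, if_pos (mem_range.2 hi)]
  intro j hj
  rw [h.left i hi j (mem_range.1 hj), sub_mul, smul_mul_assoc]
  split_ifs <;> simp

theorem IsResolvent.rowMul_mul (h : IsResolvent e N u t) (Y : ℕ → A) {j : ℕ} (hj : j < N) :
    ∑ k ∈ range N, rowMul N t Y k * e k j = u • rowMul N t Y j - Y j := by
  simp_rw [rowMul, sum_mul, smul_sum, mul_assoc]
  rw [sum_comm]
  simp_rw [← mul_sum]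
  rw [sum_congr rfl (g := fun i => u • (Y i * t i j) - if i = j then Y i else 0),
    sum_sub_distrib, sum_ite_eq', if_pos (mem_range.2 hj)]
  intro i hi
  rw [h.right i (mem_range.1 hi) j hj, mul_sub, mul_smul_comm]
  split_ifs <;> simp

omit [Algebra ℂ A] in
theorem sum_rowMul_mul (X Y : ℕ → A) :
    ∑ i ∈ range N, rowMul N t Y i * X i = ∑ i ∈ range N, Y i * mulCol N t X i := by
  simp_rw [rowMul, mulCol, sum_mul, mul_sum, mul_assoc]
  exact sum_comm

/-- The inverse of the block matrix `u - E` of size `N + 1`, from the inverse `t` of the block of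
size `N` and the inverse `Z` of its Schur complement. -/
def blockInv (e : ℕ → ℕ → A) (N : ℕ) (t : ℕ → ℕ → A) (Z : A) (i j : ℕ) : A :=
  (if i < N ∧ j < N then t i j else 0) +
    (if i < N then mulCol N t (fun i => e i N) i else 1) * Z *
      (if j < N then rowMul N t (fun i => e N i) j else 1)

theorem IsResolvent.isResolvent_blockInv (h : IsResolvent e N u t) {Z : A} (h1 : Z * schur e N u t = 1)
    (h2 : schur e N u t * Z = 1) : IsResolvent e (N + 1) u (blockInv e N t Z) := by
  set S := schur e N u t with hS
  set V := mulCol N t (fun i => e i N) with hV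
  set W := rowMul N t (fun i => e N i) with hW
  have hS' : ∑ i ∈ range N, e N i * V i + e N N = u • 1 - S := by
    rw [hS, schur]; abel
  have hS'' : ∑ i ∈ range N, W i * e i N + e N N = u • 1 - S := by
    rw [← hS', hW, hV, sum_rowMul_mul]
  constructor
  · intro i hi j hj
    have key : ∀ j : ℕ, ∑ k ∈ range N, e i k * blockInv e N t Z k j =
        (if j < N then ∑ k ∈ range N, e i k * t k j else 0) +
          (∑ k ∈ range N, e i k * V k) * Z * (if j < N then W j else 1) := by
      intro j
      rw [mul_assoc, sum_mul]
      split_ifs with hj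
      · rw [← sum_add_distrib]
        refine sum_congr rfl fun k hk => ?_
        simp [blockInv, mem_range.1 hk, hj, ← hV, ← hW, mul_add, mul_assoc]
      · rw [zero_add]
        refine sum_congr rfl fun k hk => ?_
        simp [blockInv, mem_range.1 hk, hj, ← hV, mul_assoc]
    rw [sum_range_succ, key]
    rcases Nat.lt_succ_iff_lt_or_eq.1 hi with hi | rfl
    · rw [h.mul_mulCol _ hi]
      rcases Nat.lt_succ_iff_lt_or_eq.1 hj with hj | rfl
      · simp [blockInv, hi, hj, ← hV, ← hW, h.left i hi j hj, sub_mul, mul_assoc]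
        abel
      · simp [blockInv, hi, ← hV, sub_mul, hi.ne]
    · have h3 : ∑ k ∈ range i, e i k * V k = u • 1 - S - e i i := by rw [← hS']; abel
      rw [h3, sub_mul (u • 1 - S), sub_mul (u • 1), h2]
      rcases Nat.lt_succ_iff_lt_or_eq.1 hj with hj | rfl
      · have h4 : ∑ k ∈ range i, e i k * t k j = W j := rfl
        simp [blockInv, hj, ← hW, sub_mul, mul_assoc, hj.ne', h4]
        abel
      · simp [blockInv]
  · intro i hi j hj
    have key : ∀ i : ℕ, ∑ k ∈ range N, blockInv e N t Z i k * e k j =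
        (if i < N then ∑ k ∈ range N, t i k * e k j else 0) +
          (if i < N then V i else 1) * Z * (∑ k ∈ range N, W k * e k j) := by
      intro i
      rw [mul_sum]
      split_ifs with hi
      · rw [← sum_add_distrib]
        refine sum_congr rfl fun k hk => ?_
        simp [blockInv, mem_range.1 hk, hi, ← hV, ← hW, add_mul, mul_assoc]
      · rw [zero_add]
        refine sum_congr rfl fun k hk => ?_
        simp [blockInv, mem_range.1 hk, hi, ← hW, mul_assoc]
    rw [sum_range_succ, key]
    rcases Nat.lt_succ_iff_lt_or_eq.1 hj with hj | rfl
    · rw [h.rowMul_mul _ hj]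
      rcases Nat.lt_succ_iff_lt_or_eq.1 hi with hi | rfl
      · simp [blockInv, hi, hj, ← hV, ← hW, h.right i hi j hj, mul_sub, mul_assoc]
        abel
      · simp [blockInv, hj, ← hW, mul_sub, hj.ne']
    · have h3 : ∑ k ∈ range j, W k * e k j = u • 1 - S - e j j := by rw [← hS'']; abel
      rw [h3, mul_sub, mul_sub, mul_assoc _ Z S, h1]
      rcases Nat.lt_succ_iff_lt_or_eq.1 hi with hi | rfl
      · have h4 : ∑ k ∈ range j, t i k * e k j = V i := rfl
        simp [blockInv, hi, ← hV, mul_assoc, hi.ne, h4]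
        abel
      · simp [blockInv]

omit [Algebra ℂ A] in
theorem blockInv_last (e : ℕ → ℕ → A) (N : ℕ) (t : ℕ → ℕ → A) (Z : A) :
    blockInv e N t Z N N = Z := by simp [blockInv]

/-- The resolvent identity for the parameters `u - 1` and `u`. It follows by evaluating the triple
product `p E q` of two resolvents with both bracketings (`aux`). -/
theorem IsResolvent.mul_shift (h : IsResolvent e N u t) (h₁ : IsResolvent e N (u - 1) t₁)
    {a c : ℕ} (ha : a < N) (hc : c < N) :
    ∑ b ∈ range N, t₁ a b * t b c = t₁ a c - t a c ∧
      ∑ b ∈ range N, t a b * t₁ b c = t₁ a c - t a c := by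
  have aux : ∀ (v w : ℂ) (p q : ℕ → ℕ → A), IsResolvent e N v p → IsResolvent e N w q →
      w • (∑ b ∈ range N, p a b * q b c) - p a c = v • (∑ b ∈ range N, p a b * q b c) - q a c := by
    intro v w p q hp hq
    have h1 : ∑ b ∈ range N, p a b * (w • q b c - if b = c then 1 else 0) =
        ∑ b ∈ range N, (v • p a b - if a = b then 1 else 0) * q b c := by
      rw [sum_congr rfl fun b hb => congrArg (p a b * ·) (hq.left b (mem_range.1 hb) c hc).symm,
        sum_congr rfl fun b hb => congrArg (· * q b c) (hp.right a ha b (mem_range.1 hb)).symm]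
      simp_rw [mul_sum, sum_mul]
      rw [sum_comm]
      simp_rw [mul_assoc]
    simpa [mul_sub, sub_mul, sum_sub_distrib, smul_sum, ha, hc] using h1
  constructor
  · have h1 := aux _ _ _ _ h₁ h
    rw [sub_smul, one_smul] at h1
    grind
  · have h1 := aux _ _ _ _ h h₁
    rw [sub_smul, one_smul] at h1
    grind

/-- The trace of the block inverse. -/
theorem IsResolvent.trace_blockInv (h : IsResolvent e N u t) (h₁ : IsResolvent e N (u - 1) t₁)
    (he : GLRel n e) (hN : N < n) {Z : A} (hZ : Z * schur e N u t = 1)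
    (hZ' : schur e N u t * Z = 1)
    (hV : ∀ l < N, mulCol N t₁ (fun i => e i N) l * schur e N u t =
      schur e N u t * mulCol N t (fun i => e i N) l) :
    1 - ∑ a ∈ range (N + 1), blockInv e N t Z a a =
      Z * schur e N (u - 1) t₁ * (1 - ∑ a ∈ range N, t₁ a a) := by
  have hvec := h₁.vectorOp he hN.le (vectorOp_lastCol he hN)
  have hSt : ∀ a < N, ∀ k < N, t a k * schur e N (u - 1) t₁ = schur e N (u - 1) t₁ * t a k :=
    fun a ha k hk => h.comm_of_comm (fun i hi j hj => h₁.comm_schur he hN hi hj) ha hk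
  have hcr := fun a k ha hk => h₁.comm_col_row (a := a) (k := k) he hN ha hk
  set S := schur e N u t with hS
  set S₁ := schur e N (u - 1) t₁ with hS₁
  set V := mulCol N t (fun i => e i N) with hVdef
  set V₁ := mulCol N t₁ (fun i => e i N) with hV₁def
  set W := rowMul N t (fun i => e N i) with hW
  set θ := ∑ a ∈ range N, t a a with hθ
  set θ₁ := ∑ a ∈ range N, t₁ a a with hθ₁
  -- Conjugation by the inverse `Z` of `S` turns `V₁ S = S V` into a rule for moving `Z` to the
  -- left.
  have hVZ : ∀ l < N, V l * Z = Z * V₁ l := by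
    intro l hl
    calc V l * Z = Z * S * V l * Z := by rw [hZ, one_mul]
      _ = Z * (S * V l) * Z := by noncomm_ring
      _ = Z * V₁ l * (S * Z) := by rw [← hV l hl]; noncomm_ring
      _ = _ := by rw [hZ', mul_one]
  -- The factors are in the wrong order for a matrix product; swapping them by `comm_vectorOp`
  -- creates the trace `θ`, and `t V₁ = V₁ - V` by the resolvent identity.
  have hQ : ∀ k < N, ∑ a ∈ range N, V₁ a * t k a = (V₁ k - V k) * (1 - θ) := by
    intro k hk
    have h1 : ∑ i ∈ range N, t k i * V₁ i = V₁ k - V k := by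
      simp_rw [hV₁def, hVdef, mulCol, mul_sum, ← mul_assoc]
      rw [sum_comm, ← sum_sub_distrib]
      refine sum_congr rfl fun j hj => ?_
      rw [← sum_mul, (h.mul_shift h₁ hk (mem_range.1 hj)).2, sub_mul]
    have h2 : ∀ a ∈ range N, V₁ a * t k a = t k a * V₁ a - (V₁ k - V k) * t a a := by
      intro a ha
      have := h.comm_vectorOp hvec hk (mem_range.1 ha) (mem_range.1 ha)
      rw [mulCol, h1] at this
      rw [← this]; abel
    rw [sum_congr rfl h2, sum_sub_distrib, h1, ← mul_sum, mul_sub, mul_one]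
  have hYV : ∑ k ∈ range N, e N k * V k = u • 1 - e N N - S := by rw [hS, schur]; abel
  have hYV₁ : ∑ k ∈ range N, e N k * V₁ k = (u - 1) • 1 - e N N - S₁ := by
    rw [hS₁, schur]; abel
  -- Moving `V₁ a` past the row `e N k` produces `S₁` through `comm_col_row`; what is left is summed
  -- by `hQ` and `mul_shift`.
  have hVW : ∑ a ∈ range N, V₁ a * W a = S * (1 - θ) - 1 - S₁ * (1 - θ₁) := by
    have h1 : ∀ a ∈ range N, V₁ a * W a = ∑ k ∈ range N, (e N k * (V₁ a * t k a) +
        S₁ * (t₁ a k * t k a)) - t a a := by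
      intro a ha
      have ha := mem_range.1 ha
      rw [hW, rowMul, mul_sum, sum_congr rfl (g := fun k => (e N k * (V₁ a * t k a) +
        S₁ * (t₁ a k * t k a)) - if a = k then t k a else 0), sum_sub_distrib, sum_ite_eq,
        if_pos (mem_range.2 ha)]
      intro k hk
      have hk := mem_range.1 hk
      have h2 := hcr a k ha hk
      rw [h₁.comm_of_comm (fun i hi j hj => h₁.comm_schur he hN hi hj) ha hk, ← hS₁] at h2
      calc V₁ a * (e N k * t k a) = e N k * (V₁ a * t k a) +
            (V₁ a * e N k - e N k * V₁ a) * t k a := by noncomm_ring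
        _ = _ := by rw [h2]; split_ifs <;> simp [sub_mul, mul_assoc]; abel
    rw [sum_congr rfl h1, sum_sub_distrib, ← hθ]
    simp_rw [sum_add_distrib, ← mul_sum]
    rw [sum_congr rfl (f := fun a => ∑ k ∈ range N, t₁ a k * t k a) (g := fun a => t₁ a a - t a a)
      (fun a ha => (h.mul_shift h₁ (mem_range.1 ha) (mem_range.1 ha)).1), sum_sub_distrib,
      ← hθ, ← hθ₁, sum_comm]
    simp_rw [← mul_sum]
    rw [sum_congr rfl fun k hk => by rw [hQ k (mem_range.1 hk)]]
    simp_rw [← mul_assoc]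
    rw [← sum_mul]
    simp_rw [mul_sub (e N _)]
    rw [sum_sub_distrib, hYV, hYV₁, sub_smul, one_smul]
    noncomm_ring
  have h3 : ∀ a ∈ range N, blockInv e N t Z a a = t a a + Z * (V₁ a * W a) := by
    intro a ha
    have ha := mem_range.1 ha
    simp [blockInv, ha, ← hVdef, ← hW, hVZ a ha, mul_assoc]
  rw [sum_range_succ, blockInv_last, sum_congr rfl h3, sum_add_distrib, ← mul_sum, hVW, ← hθ,
    mul_sub, mul_sub, ← mul_assoc, hZ]
  noncomm_ring

end Resolvent

/-! ### Partial fractions with nodes that may collide in pairs -/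

section Interpolation

open Polynomial

variable {ι : Type*} [DecidableEq ι]

/-- The polynomial `K + J` with `K = ∏ (X - a i)` and `J = ∑ c i ∏_{j ≠ i} (X - a j)`. -/
noncomputable def partialFrac (I : Finset ι) (a c : ι → ℂ) : ℂ[X] :=
  ∏ i ∈ I, (X - C (a i)) + ∑ i ∈ I, C (c i) * ∏ j ∈ I.erase i, (X - C (a j))

variable {I : Finset ι} {a c : ι → ℂ} {g : ℂ[X]}

omit [DecidableEq ι] in
theorem monic_prod_X_sub (I : Finset ι) (a : ι → ℂ) : (∏ i ∈ I, (X - C (a i))).Monic :=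
  monic_prod_of_monic _ _ fun _ _ => monic_X_sub_C _

omit [DecidableEq ι] in
theorem natDegree_prod_X_sub (I : Finset ι) (a : ι → ℂ) :
    (∏ i ∈ I, (X - C (a i))).natDegree = #I := by
  rw [natDegree_prod_of_monic _ _ fun _ _ => monic_X_sub_C _]
  simp

theorem degree_sum_erase_lt (I : Finset ι) (a c : ι → ℂ) :
    (∑ i ∈ I, C (c i) * ∏ j ∈ I.erase i, (X - C (a j))).degree < #I := by
  refine (degree_sum_le _ _).trans_lt ((Finset.sup_lt_iff (WithBot.bot_lt_coe _)).2 fun i hi => ?_)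
  rw [← smul_eq_C_mul]
  refine (degree_smul_le _ _).trans_lt ?_
  rw [degree_eq_natDegree (monic_prod_X_sub _ _).ne_zero, natDegree_prod_X_sub,
    card_erase_of_mem hi]
  have := card_pos.2 ⟨i, hi⟩
  exact_mod_cast (by omega)

theorem degree_sub_partialFrac_lt (hg : g.Monic) (hd : g.natDegree = #I) :
    (g - partialFrac I a c).degree < #I := by
  rw [partialFrac, ← sub_sub]
  refine (degree_sub_le _ _).trans_lt (max_lt ?_ (degree_sum_erase_lt I a c))
  have h := degree_sub_lt_left (p := g) (q := ∏ i ∈ I, (X - C (a i))) ?_ hg.ne_zero ?_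
  · rwa [degree_eq_natDegree hg.ne_zero, hd] at h
  · rw [degree_eq_natDegree hg.ne_zero, hd,
      degree_eq_natDegree (monic_prod_X_sub _ _).ne_zero, natDegree_prod_X_sub]
  · rw [hg.leadingCoeff, (monic_prod_X_sub _ _).leadingCoeff]

theorem eval_partialFrac {i : ι} (hi : i ∈ I) :
    (partialFrac I a c).eval (a i) = c i * ∏ j ∈ I.erase i, (a i - a j) := by
  simp only [partialFrac, eval_add, eval_prod, eval_sub, eval_X, eval_C, eval_finsetSum, eval_mul]
  rw [prod_eq_zero hi (sub_self _), zero_add, sum_eq_single i]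
  · intro k hk hki
    rw [prod_eq_zero (mem_erase.2 ⟨hki.symm, hi⟩) (sub_self _), mul_zero]
  · exact fun h => (h hi).elim

/-- A product that omits one of the two equal factors occurs only with a vanishing coefficient. -/
theorem sq_dvd_partialFrac {i j : ι} (hi : i ∈ I) (hj : j ∈ I) (hij : i ≠ j) (ha : a i = a j)
    (hci : c i = 0) (hcj : c j = 0) : (X - C (a i)) ^ 2 ∣ partialFrac I a c := by
  have aux : ∀ s : Finset ι, i ∈ s → j ∈ s → (X - C (a i)) ^ 2 ∣ ∏ k ∈ s, (X - C (a k)) := by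
    intro s hi hj
    have := prod_dvd_prod_of_subset {i, j} s (fun k => X - C (a k))
      (by simp [insert_subset_iff, hi, hj])
    rwa [prod_pair hij, ← ha, ← sq] at this
  refine dvd_add (aux I hi hj) (dvd_sum fun k _ => ?_)
  by_cases h1 : k = i
  · simp [h1, hci]
  by_cases h2 : k = j
  · simp [h2, hcj]
  exact (aux _ (mem_erase.2 ⟨Ne.symm h1, hi⟩) (mem_erase.2 ⟨Ne.symm h2, hj⟩)).mul_left _

/-- The difference of the two sides has degree less than `#I`, yet it vanishes at all nodes with
multiplicity: simple nodes by the residue condition, double ones because both sides have a double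
root. -/
theorem eq_partialFrac (hg : g.Monic) (hd : g.natDegree = #I)
    (hs : ∀ i ∈ I, (∀ j ∈ I, j ≠ i → a j ≠ a i) →
      c i * ∏ j ∈ I.erase i, (a i - a j) = g.eval (a i))
    (hdbl : ∀ i ∈ I, ∀ j ∈ I, i ≠ j → a i = a j → c i = 0 ∧ (X - C (a i)) ^ 2 ∣ g)
    (hcard : ∀ x, #{i ∈ I | a i = x} ≤ 2) : g = partialFrac I a c := by
  rw [← sub_eq_zero]
  by_contra hP
  have hlt := degree_sub_partialFrac_lt (a := a) (c := c) hg hd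
  set P := g - partialFrac I a c with hPdef
  have hK : ((I.val.map a).map fun x => X - C x).prod ∣ P := by
    rw [Multiset.prod_X_sub_C_dvd_iff_le_roots hP, Multiset.le_iff_count]
    intro x
    rw [count_roots, le_rootMultiplicity_iff hP, Multiset.count_map]
    have hc : Multiset.card (Multiset.filter (fun i => x = a i) I.val) = #{i ∈ I | a i = x} := by
      simp [Finset.card, eq_comm]
    rw [hc]
    have h2 := hcard x
    interval_cases h : #{i ∈ I | a i = x}
    · simp
    · obtain ⟨i, hi⟩ := card_eq_one.1 h
      have hi' : i ∈ I ∧ a i = x := by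
        have : i ∈ ({i} : Finset ι) := mem_singleton_self i
        rwa [← hi, mem_filter] at this
      rw [pow_one, dvd_iff_isRoot, IsRoot, hPdef, eval_sub, ← hi'.2, eval_partialFrac hi'.1,
        hs i hi'.1, sub_self]
      intro j hj hji haj
      have : j ∈ ({i} : Finset ι) := by
        rw [← hi, mem_filter]
        exact ⟨hj, haj.trans hi'.2⟩
      exact hji (mem_singleton.1 this)
    · obtain ⟨i, j, hij, hi⟩ := card_eq_two.1 h
      have hi' : i ∈ I ∧ a i = x := by
        have : i ∈ ({i, j} : Finset ι) := mem_insert_self _ _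
        rwa [← hi, mem_filter] at this
      have hj' : j ∈ I ∧ a j = x := by
        have : j ∈ ({i, j} : Finset ι) := by simp
        rwa [← hi, mem_filter] at this
      have haij := hi'.2.trans hj'.2.symm
      have h1 := hdbl i hi'.1 j hj'.1 hij haij
      rw [← hi'.2]
      exact dvd_sub h1.2 (sq_dvd_partialFrac hi'.1 hj'.1 hij haij h1.1
        (hdbl j hj'.1 i hi'.1 hij.symm haij.symm).1)
  have hK' : ∏ i ∈ I, (X - C (a i)) ∣ P := by
    rwa [Multiset.map_map] at hK
  have h3 := degree_le_of_dvd hK' hP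
  rw [degree_eq_natDegree (monic_prod_X_sub _ _).ne_zero, natDegree_prod_X_sub] at h3
  exact absurd (hlt.trans_le h3) (lt_irrefl _)

theorem coeff_partialFrac (hI : I.Nonempty) :
    (partialFrac I a c).coeff (#I - 1) = -∑ i ∈ I, a i + ∑ i ∈ I, c i := by
  have hpos := card_pos.2 hI
  rw [partialFrac, coeff_add, finsetSum_coeff]
  congr 1
  · rw [prod_X_sub_C_coeff_card_pred _ _ hpos]
  · refine sum_congr rfl fun i hi => ?_
    have h := (monic_prod_X_sub (I.erase i) a).coeff_natDegree
    rw [natDegree_prod_X_sub, card_erase_of_mem hi] at h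
    rw [coeff_C_mul, h, mul_one]

/-- With one collision there are only `#I - 1` distinct nodes. Agreement of the subleading
coefficients lowers the degree of the difference by one more, so vanishing at these nodes still
forces it to be zero, and the partial fraction side has the double root. -/
theorem sq_dvd_of_single_collision (hg : g.Monic) (hd : g.natDegree = #I) {i₀ j₀ : ι}
    (hi₀ : i₀ ∈ I) (hj₀ : j₀ ∈ I) (hij : i₀ ≠ j₀) (ha : a i₀ = a j₀)
    (hcol : ∀ i ∈ I, ∀ j ∈ I, i ≠ j → a i = a j → i = j₀ ∨ j = j₀)
    (hci : c i₀ = 0) (hcj : c j₀ = 0) (hg₀ : g.eval (a i₀) = 0)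
    (hs : ∀ i ∈ I, (∀ j ∈ I, j ≠ i → a j ≠ a i) →
      c i * ∏ j ∈ I.erase i, (a i - a j) = g.eval (a i))
    (hco : g.coeff (#I - 1) = -∑ i ∈ I, a i + ∑ i ∈ I, c i) : (X - C (a i₀)) ^ 2 ∣ g := by
  have hlt := degree_sub_partialFrac_lt (a := a) (c := c) hg hd
  have hP : g - partialFrac I a c = 0 := by
    have hcard : #(I.erase j₀) = #I - 1 := card_erase_of_mem hj₀
    refine eq_zero_of_degree_lt_of_eval_index_eq_zero (v := a) (I.erase j₀) ?_ ?_ ?_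
    · intro i hi j hj haij
      by_contra hne
      rcases hcol i (mem_of_mem_erase hi) j (mem_of_mem_erase hj) hne haij with h | h
      · exact (mem_erase.1 hi).1 h
      · exact (mem_erase.1 hj).1 h
    · rw [hcard, degree_lt_iff_coeff_zero]
      intro m hm
      rcases hm.eq_or_lt with rfl | hm
      · rw [coeff_sub, hco, coeff_partialFrac ⟨i₀, hi₀⟩, sub_self]
      · exact (degree_lt_iff_coeff_zero _ _).1 hlt m (by omega)
    · intro i hi
      obtain ⟨hne, hiI⟩ := mem_erase.1 hi
      rw [eval_sub, eval_partialFrac hiI]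
      by_cases h : ∀ j ∈ I, j ≠ i → a j ≠ a i
      · rw [hs i hiI h, sub_self]
      · push Not at h
        obtain ⟨j, hj, hji, haj⟩ := h
        rcases hcol j hj i hiI hji haj with rfl | rfl
        · by_cases hii : i = i₀
          · subst hii
            rw [hg₀, hci, zero_mul, sub_zero]
          · rcases hcol i hiI i₀ hi₀ hii (haj.symm.trans ha.symm) with h | h
            · exact (hne h).elim
            · exact (hij h).elim
        · exact (hne rfl).elim
  rw [sub_eq_zero.1 hP]
  exact sq_dvd_partialFrac hi₀ hj₀ hij ha hci hcj

end Interpolation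

/-! ### Realizations, admissible moves, and the order generated by the relations -/

section Combinatorics

variable {n : ℕ} {C : Set (Rel n)} {L R : Tableau n}

theorem mem_rowSet {k : ℕ} {p : Pos n} : p ∈ rowSet n k ↔ p.row = k := by
  simp [rowSet]

theorem card_rowSet {k : ℕ} (hk : k ≤ n) : #(rowSet n k) = k := by
  rcases Nat.eq_zero_or_pos k with rfl | hpos
  · rw [card_eq_zero, eq_empty_iff_forall_notMem]
    intro p hp
    simp [mem_rowSet, Pos.row] at hp
  · have h : rowSet n k = (univ : Finset (Fin k)).map
        ⟨fun j => ⟨⟨k - 1, by omega⟩, ⟨j, by simp; omega⟩⟩, fun i j hij =>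
          Fin.ext (congrArg (fun p : Pos n => (p.2 : ℕ)) hij)⟩ := by
      ext ⟨i, j⟩
      simp only [mem_rowSet, Pos.row, mem_map, mem_univ, true_and]
      constructor
      · rintro rfl
        exact ⟨j, rfl⟩
      · rintro ⟨x, hx⟩
        have : k - 1 = (i : ℕ) := congrArg (fun p : Pos n => (p.1 : ℕ)) hx
        omega
    rw [h, card_map, card_univ, Fintype.card_fin]

/-- The tableaux `T(L + z)` with `z` integral, whose top row may be nonzero. -/
def IntShift (L R : Tableau n) : Prop := ∃ z : Pos n → ℤ, ∀ p, R p = L p + (z p : ℂ)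

/-- The condition on rows sees the entries only modulo integers. The top row may move as well, so
admissibility applies to realizations outside the given module. -/
theorem IsRealization.of_intShift (hL : IsRealization C L) (hLR : IntShift L R)
    (hR : Satisfies C R) : IsRealization C R := by
  obtain ⟨z, hz⟩ := hLR
  refine ⟨hR, fun p q hpq hne => ?_⟩
  rw [← hL.2 p q hpq hne]
  constructor
  · rintro ⟨m, hm⟩
    exact ⟨m - z p + z q, by push_cast; rw [← hm, hz, hz]; ring⟩
  · rintro ⟨m, hm⟩
    exact ⟨m + z p - z q, by push_cast; rw [← hm, hz, hz]; ring⟩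

theorem self_mem_tableaux (hL : Satisfies C L) : L ∈ tableaux C L :=
  ⟨⟨0, fun _ _ => rfl, fun p => by simp⟩, hL⟩

theorem intShift_of_mem (hR : R ∈ tableaux C L) : IntShift L R :=
  ⟨_, hR.1.choose_spec.2⟩

theorem IsRealization.noncritical (hL : IsRealization C L) (hC : Admissible C) :
    Noncritical L := by
  obtain ⟨ρ, hρ⟩ := hC.2 L hL
  exact hρ.noncritical L (self_mem_tableaux hL.1)

/-- Raising an entry by one can break a relation only when it is tight: equality with an entry above
in `≥`, or a gap of exactly one to an entry below in `>`. -/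
theorem satisfies_add_delta (hC : C ⊆ relR n ∪ relR0 n) (hR : Satisfies C R) {p : Pos n}
    (hp : p.row < n) (h₁ : ∀ s, s.row = p.row + 1 → R s ≠ R p)
    (h₂ : ∀ s, s.row + 1 = p.row → R s ≠ R p + 1) : Satisfies C (R + delta p) := by
  intro r hr
  have hh := hR r hr
  rcases hC hr with ⟨a, b, hab, rfl | rfl⟩ | ⟨a, b, ha, hb, -, rfl⟩
  · obtain ⟨m, hm, hm'⟩ := hh
    by_cases hap : a = p
    · have hbp : b ≠ p := by rintro rfl; subst hap; omega
      exact ⟨m + 1, by omega, by simp [delta, hap, hbp, ← hm']; ring⟩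
    by_cases hbp : b = p
    · subst hbp
      have hne := h₁ a hab
      have : m ≠ 0 := by rintro rfl; exact hne (by simpa [sub_eq_zero] using hm')
      exact ⟨m - 1, by omega, by simp [delta, hap, ← hm']; ring⟩
    · exact ⟨m, hm, by simp [delta, hap, hbp, ← hm']⟩
  · obtain ⟨m, hm, hm'⟩ := hh
    by_cases hbp : b = p
    · have hap : a ≠ p := by rintro rfl; subst hbp; omega
      exact ⟨m + 1, by omega, by simp [delta, hap, hbp, ← hm']; ring⟩
    by_cases hap : a = p
    · subst hap
      have hne := h₂ b hab.symm
      have : m ≠ 1 := by rintro rfl; exact hne (by simpa [sub_eq_iff_eq_add'] using hm')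
      exact ⟨m - 1, by omega, by simp [delta, hbp, ← hm']; ring⟩
    · exact ⟨m, hm, by simp [delta, hap, hbp, ← hm']⟩
  · obtain ⟨m, hm, hm'⟩ := hh
    have hap : a ≠ p := by rintro rfl; omega
    have hbp : b ≠ p := by rintro rfl; omega
    exact ⟨m, hm, by simp [delta, hap, hbp, ← hm']⟩

theorem satisfies_sub_delta (hC : C ⊆ relR n ∪ relR0 n) (hR : Satisfies C R) {p : Pos n}
    (hp : p.row < n) (h₁ : ∀ s, s.row + 1 = p.row → R p ≠ R s)
    (h₂ : ∀ s, s.row = p.row + 1 → R p ≠ R s + 1) : Satisfies C (R - delta p) := by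
  intro r hr
  have hh := hR r hr
  rcases hC hr with ⟨a, b, hab, rfl | rfl⟩ | ⟨a, b, ha, hb, -, rfl⟩
  · obtain ⟨m, hm, hm'⟩ := hh
    by_cases hap : a = p
    · have hbp : b ≠ p := by rintro rfl; subst hap; omega
      subst hap
      have hne := h₁ b hab.symm
      have : m ≠ 0 := by rintro rfl; exact hne (by simpa [sub_eq_zero] using hm')
      exact ⟨m - 1, by omega, by simp [delta, hbp, ← hm']; ring⟩
    by_cases hbp : b = p
    · exact ⟨m + 1, by omega, by simp [delta, hap, hbp, ← hm']; ring⟩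
    · exact ⟨m, hm, by simp [delta, hap, hbp, ← hm']⟩
  · obtain ⟨m, hm, hm'⟩ := hh
    by_cases hbp : b = p
    · have hap : a ≠ p := by rintro rfl; subst hbp; omega
      subst hbp
      have hne := h₂ a hab
      have : m ≠ 1 := by rintro rfl; exact hne (by simpa [sub_eq_iff_eq_add'] using hm')
      exact ⟨m - 1, by omega, by simp [delta, hap, ← hm']; ring⟩
    by_cases hap : a = p
    · exact ⟨m + 1, by omega, by simp [delta, hbp, hap, ← hm']; ring⟩
    · exact ⟨m, hm, by simp [delta, hap, hbp, ← hm']⟩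
  · obtain ⟨m, hm, hm'⟩ := hh
    have hap : a ≠ p := by rintro rfl; omega
    have hbp : b ≠ p := by rintro rfl; omega
    exact ⟨m, hm, by simp [delta, hap, hbp, ← hm']⟩

/-- `C` contains the relation `a ≥ b` or `a > b`. -/
def Above (C : Set (Rel n)) (a b : Pos n) : Prop := Rel.ge a b ∈ C ∨ Rel.gt a b ∈ C

/-- `a` is at least `b` by a chain of relations of `C`. -/
abbrev Dominates (C : Set (Rel n)) : Pos n → Pos n → Prop := Relation.ReflTransGen (Above C)

theorem Dominates.sub_nonneg {a b : Pos n} (h : Dominates C a b) (hR : Satisfies C R) :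
    ∃ m : ℕ, R a - R b = m := by
  induction h with
  | refl => exact ⟨0, by simp⟩
  | tail _ h ih =>
    obtain ⟨m, hm⟩ := ih
    obtain ⟨k, hk, hk'⟩ : ∃ k : ℤ, 0 ≤ k ∧ R _ - R _ = (k : ℂ) := by
      rcases h with h | h <;> obtain ⟨k, hk, hk'⟩ := hR _ h
      · exact ⟨k, hk, hk'⟩
      · exact ⟨k, hk.le, hk'⟩
    lift k to ℕ using hk
    refine ⟨m + k, ?_⟩
    push_cast at hk' ⊢
    rw [← hm, ← hk']
    ring

theorem satisfies_add_mono (hR : Satisfies C R) {f : Pos n → ℕ}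
    (hf : ∀ a b, Above C a b → f b ≤ f a) : Satisfies C (fun p => R p + f p) := by
  intro r hr
  have hh := hR r hr
  cases r with
  | ge p q =>
    obtain ⟨m, hm, hm'⟩ := hh
    have := hf p q (.inl hr)
    exact ⟨m + f p - f q, by omega, by push_cast; rw [← hm']; ring⟩
  | gt p q =>
    obtain ⟨m, hm, hm'⟩ := hh
    have := hf p q (.inr hr)
    exact ⟨m + f p - f q, by omega, by push_cast; rw [← hm']; ring⟩

theorem IsRealization.add_mono (hR : IsRealization C R) {f : Pos n → ℕ}
    (hf : ∀ a b, Above C a b → f b ≤ f a) : IsRealization C (fun p => R p + f p) :=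
  hR.of_intShift ⟨fun p => f p, fun p => by simp⟩ (satisfies_add_mono hR.1 hf)

open Classical in
/-- Entries of one row below the top row that differ by an integer are linked by a chain of
relations. -/
theorem IsRealization.dominates (hC : Admissible C) (hR : IsRealization C R) {p q : Pos n}
    (hpq : p.row = q.row) (hp : p.row < n) {m : ℕ} (hm : R q - R p = m) (hne : q ≠ p) :
    Dominates C q p := by
  by_contra h
  -- Everything that dominates `p` is lifted by `m`. This respects `C` and leaves `q` fixed, so `p`
  -- and `q` coincide in a new realization, which admissibility forbids.
  have h1 := (hR.add_mono (f := fun v => if Dominates C v p then m else 0) ?_).noncritical hC p q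
    hpq hp hne.symm
  · apply h1
    simp only [h, if_false, if_pos (Relation.ReflTransGen.refl : Dominates C p p), ← hm]
    simp
  · intro a b hab
    by_cases h1 : Dominates C b p
    · simp [h1, h1.head hab]
    · simp [h1]

end Combinatorics

attribute [local instance 100] LieRing.ofAssociativeRing

/-! ### Products of raising and lowering operators on tableaux -/

section Action

variable {n : ℕ} {C : Set (Rel n)} {L R : Tableau n} {ρ : GLAction C L}

theorem matUnit_mul {n i j k l : ℕ} (hi : i < n) (hj : j < n) (hk : k < n) (hl : l < n) :
    matUnit n (i + 1) (j + 1) * matUnit n (k + 1) (l + 1) =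
      if j = k then matUnit n (i + 1) (l + 1) else 0 := by
  have key : ∀ a b : ℕ, ∀ (ha : a < n) (hb : b < n),
      matUnit n (a + 1) (b + 1) = Matrix.single ⟨a, ha⟩ ⟨b, hb⟩ 1 := by
    intro a b ha hb
    ext x y
    simp [matUnit, Matrix.single_apply, Fin.ext_iff, eq_comm]
  rw [key i j hi hj, key k l hk hl, key i l hi hl]
  split_ifs with h
  · subst h
    rw [Matrix.single_mul_single_same, one_mul]
  · rw [Matrix.single_mul_single_of_ne]
    simpa using h

theorem lie_matUnit {n i j k l : ℕ} (hi : i < n) (hj : j < n) (hk : k < n) (hl : l < n) :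
    ⁅matUnit n (i + 1) (j + 1), matUnit n (k + 1) (l + 1)⁆ =
      (if j = k then matUnit n (i + 1) (l + 1) else 0) -
        if l = i then matUnit n (k + 1) (j + 1) else 0 := by
  rw [LieRing.of_associative_ring_bracket, matUnit_mul hi hj hk hl, matUnit_mul hk hl hi hj]

theorem glRel_lieHom {A : Type*} [Ring A] [Algebra ℂ A]
    (f : Matrix (Fin n) (Fin n) ℂ →ₗ⁅ℂ⁆ A) :
    GLRel n (fun i j => f (matUnit n (i + 1) (j + 1))) := by
  intro i j k l hi hj hk hl
  have h := congrArg f (lie_matUnit hi hj hk hl)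
  rw [LieHom.map_lie, LieRing.of_associative_ring_bracket, map_sub] at h
  rw [h]
  split_ifs <;> simp

/-- The operators by which the matrix units act, with indices counted from `0`. -/
noncomputable def unitOp (ρ : GLAction C L) (i j : ℕ) : Module.End ℂ (TabSpace C L) :=
  ρ (matUnit n (i + 1) (j + 1))

theorem glRel_unitOp (ρ : GLAction C L) : GLRel n (unitOp ρ) := glRel_lieHom ρ

theorem tab_of_mem (h : R ∈ tableaux C L) : tab C L R = Finsupp.single ⟨R, h⟩ 1 := by
  rw [tab, dif_pos h]

theorem tab_of_notMem (h : R ∉ tableaux C L) : tab C L R = 0 := by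
  rw [tab, dif_neg h]

open Classical in
theorem tab_apply (R : Tableau n) (T : tableaux C L) :
    tab C L R T = if R = T then 1 else 0 := by
  by_cases h : R ∈ tableaux C L
  · rw [tab_of_mem h, Finsupp.single_apply]
    simp [Subtype.ext_iff]
  · rw [tab_of_notMem h, if_neg]
    · rfl
    · rintro rfl
      exact h T.2

theorem ext_tab {M : Type*} [AddCommMonoid M] [Module ℂ M] {f g : TabSpace C L →ₗ[ℂ] M}
    (h : ∀ R ∈ tableaux C L, f (tab C L R) = g (tab C L R)) : f = g := by
  refine Finsupp.lhom_ext' fun T => LinearMap.ext_ring ?_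
  have := h T T.2
  rwa [tab_of_mem T.2] at this

theorem add_delta_mem_iff (hR : R ∈ tableaux C L) {p : Pos n} (hp : p.row < n) :
    R + delta p ∈ tableaux C L ↔ Satisfies C (R + delta p) := by
  refine ⟨fun h => h.2, fun h => ⟨?_, h⟩⟩
  obtain ⟨⟨z, hz, hz'⟩, -⟩ := hR
  refine ⟨z + Pi.single p 1, fun q hq => ?_, fun q => ?_⟩
  · have : q ≠ p := by rintro rfl; omega
    simp [hz q hq, this]
  · by_cases h : q = p
    · subst h; simp [delta, hz', add_assoc]
    · simp [delta, hz', h]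

theorem sub_delta_mem_iff (hR : R ∈ tableaux C L) {p : Pos n} (hp : p.row < n) :
    R - delta p ∈ tableaux C L ↔ Satisfies C (R - delta p) := by
  refine ⟨fun h => h.2, fun h => ⟨?_, h⟩⟩
  obtain ⟨⟨z, hz, hz'⟩, -⟩ := hR
  refine ⟨z - Pi.single p 1, fun q hq => ?_, fun q => ?_⟩
  · have : q ≠ p := by rintro rfl; omega
    simp [hz q hq, this]
  · by_cases h : q = p
    · subst h; simp [delta, hz']; ring
    · simp [delta, hz', h]

open Classical in
/-- The coefficient of the path `R → R - δ^q → R - δ^q + δ^p`. -/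
noncomputable def lowerRaise (C : Set (Rel n)) (L R : Tableau n) (p q : Pos n) : ℂ :=
  if R - delta q ∈ tableaux C L then lowerCoeff R q * raiseCoeff (R - delta q) p else 0

open Classical in
/-- The coefficient of the path `R → R + δ^p → R + δ^p - δ^q`. -/
noncomputable def raiseLower (C : Set (Rel n)) (L R : Tableau n) (p q : Pos n) : ℂ :=
  if R + delta p ∈ tableaux C L then raiseCoeff R p * lowerCoeff (R + delta p) q else 0

/-- An operator that raises the `k`-th row like `E_{k,k+1}`, with the coefficients multiplied by a
function of the raised entry. -/
def IsRaising (C : Set (Rel n)) (L : Tableau n) (k : ℕ) (φ : ℂ → ℂ)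
    (V : Module.End ℂ (TabSpace C L)) : Prop :=
  ∀ R ∈ tableaux C L, V (tab C L R) =
    ∑ p ∈ rowSet n k, (φ (R p) * raiseCoeff R p) • tab C L (R + delta p)

theorem IsGTAction.isRaising (hρ : IsGTAction C L ρ) {k : ℕ} (hk : k + 1 < n) :
    IsRaising C L (k + 1) (fun _ => 1) (unitOp ρ k (k + 1)) := by
  intro R hR
  simp only [one_mul]
  exact hρ.raise R hR (k + 1) (by omega) hk

variable {k : ℕ} {φ : ℂ → ℂ} {V : Module.End ℂ (TabSpace C L)}

/-- Here `φ` is evaluated after lowering, that is, at `R p - 1` if `p = q` and at `R p` otherwise.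
-/
theorem IsRaising.apply_lower (hV : IsRaising C L (k + 1) φ V) (hρ : IsGTAction C L ρ)
    (hk : k + 1 < n) (hR : R ∈ tableaux C L) :
    V (unitOp ρ (k + 1) k (tab C L R)) = ∑ p ∈ rowSet n (k + 1), ∑ q ∈ rowSet n (k + 1),
      (φ ((R - delta q) p) * lowerRaise C L R p q) • tab C L (R + delta p - delta q) := by
  rw [sum_comm, unitOp, hρ.lower R hR (k + 1) (by omega) hk, map_sum]
  refine sum_congr rfl fun q _ => ?_
  rw [map_smul]
  by_cases h : R - delta q ∈ tableaux C L
  · rw [hV _ h, smul_sum]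
    refine sum_congr rfl fun p _ => ?_
    rw [lowerRaise, if_pos h, smul_smul, sub_add_eq_add_sub]
    congr 1
    ring
  · rw [tab_of_notMem h, map_zero, smul_zero]
    simp [lowerRaise, h]

theorem IsRaising.lower_apply (hV : IsRaising C L (k + 1) φ V) (hρ : IsGTAction C L ρ)
    (hk : k + 1 < n) (hR : R ∈ tableaux C L) :
    unitOp ρ (k + 1) k (V (tab C L R)) = ∑ p ∈ rowSet n (k + 1), ∑ q ∈ rowSet n (k + 1),
      (φ (R p) * raiseLower C L R p q) • tab C L (R + delta p - delta q) := by
  rw [hV R hR, map_sum]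
  refine sum_congr rfl fun p _ => ?_
  rw [map_smul]
  by_cases h : R + delta p ∈ tableaux C L
  · rw [unitOp, hρ.lower _ h (k + 1) (by omega) hk, smul_sum]
    refine sum_congr rfl fun q _ => ?_
    rw [raiseLower, if_pos h, smul_smul]
    congr 1
    ring
  · rw [tab_of_notMem h, map_zero, smul_zero]
    simp [raiseLower, h]

theorem add_delta_sub_delta_inj {p q p' q' : Pos n} (hpq : p ≠ q)
    (h : R + delta p' - delta q' = R + delta p - delta q) : p' = p ∧ q' = q := by
  have h1 := congrFun h p
  have h2 := congrFun h q
  simp only [delta, Pi.sub_apply, Pi.add_apply, Pi.single_eq_same, Pi.single_eq_of_ne hpq,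
    Pi.single_eq_of_ne hpq.symm, sub_zero, add_zero, Pi.single_apply] at h1 h2
  constructor
  · by_contra hne
    rw [if_neg (Ne.symm hne)] at h1
    have h3 : (if p = q' then (1 : ℂ) else 0) = -1 := by linear_combination -h1
    split_ifs at h3 <;> norm_num at h3
  · by_contra hne
    rw [if_neg (Ne.symm hne)] at h2
    have h3 : (if q = p' then (1 : ℂ) else 0) = -1 := by linear_combination h2
    split_ifs at h3 <;> norm_num at h3

/-- The weight of `T(R)` under `E_{kk} - E_{k+1,k+1}`. -/
noncomputable def rowWeight (R : Tableau n) (k : ℕ) : ℂ :=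
  2 * ∑ p ∈ rowSet n k, R p - ∑ p ∈ rowSet n (k - 1), R p - ∑ p ∈ rowSet n (k + 1), R p - 1

theorem IsGTAction.sum_smul_tab (hρ : IsGTAction C L ρ) (hk : k + 1 < n) (hR : R ∈ tableaux C L) :
    ∑ p ∈ rowSet n (k + 1), ∑ q ∈ rowSet n (k + 1),
      (lowerRaise C L R p q - raiseLower C L R p q) • tab C L (R + delta p - delta q) =
        rowWeight R (k + 1) • tab C L R := by
  have h1 := (hρ.isRaising hk).apply_lower hρ hk hR
  have h2 := (hρ.isRaising hk).lower_apply hρ hk hR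
  simp only [one_mul] at h1 h2
  simp_rw [sub_smul, sum_sub_distrib]
  rw [← h1, ← h2]
  have h3 := glRel_unitOp ρ k (k + 1) (k + 1) k (by omega) hk hk (by omega)
  rw [if_pos rfl, if_pos rfl] at h3
  have h4 := LinearMap.congr_fun h3 (tab C L R)
  simp only [LinearMap.sub_apply, Module.End.mul_apply] at h4
  rw [h4, unitOp, unitOp, hρ.diag R hR (k + 1) (by omega) (by omega),
    hρ.diag R hR (k + 1 + 1) (by omega) (by omega), ← sub_smul, rowWeight]
  congr 1
  push_cast
  ring

/-- The commutator of `E_{k+1,k+2}` and `E_{k+2,k+1}` is diagonal, and for `p ≠ q` the target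
tableau determines the pair `(p, q)`, so no other term can cancel this one. -/
theorem IsGTAction.offDiag (hρ : IsGTAction C L ρ) (hk : k + 1 < n) (hR : R ∈ tableaux C L)
    {p q : Pos n} (hp : p ∈ rowSet n (k + 1)) (hq : q ∈ rowSet n (k + 1)) (hpq : p ≠ q) :
    (lowerRaise C L R p q - raiseLower C L R p q) • tab C L (R + delta p - delta q) = 0 := by
  classical
  by_cases hT : R + delta p - delta q ∈ tableaux C L
  swap
  · rw [tab_of_notMem hT, smul_zero]
  have h := DFunLike.congr_fun (hρ.sum_smul_tab hk hR) ⟨_, hT⟩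
  simp only [Finsupp.coe_finsetSum, Finset.sum_apply, Finsupp.smul_apply, tab_apply,
    smul_eq_mul] at h
  rw [sum_eq_single p, sum_eq_single q, if_pos rfl, mul_one, if_neg, mul_zero] at h
  · rw [h, zero_smul]
  · intro h'
    have := congrFun h' p
    simp [delta, hpq] at this
  · intro q' _ hq'
    rw [if_neg, mul_zero]
    exact fun h' => hq' (add_delta_sub_delta_inj hpq h').2
  · exact fun h' => (h' hq).elim
  · intro p' _ hp'
    refine sum_eq_zero fun q' _ => ?_
    rw [if_neg, mul_zero]
    exact fun h' => hp' (add_delta_sub_delta_inj hpq h').1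
  · exact fun h' => (h' hp).elim

/-- The commutator of a raising operator with `E_{k+1,k}` is diagonal. -/
theorem IsRaising.commutator (hV : IsRaising C L (k + 1) φ V) (hρ : IsGTAction C L ρ)
    (hk : k + 1 < n) (hR : R ∈ tableaux C L) :
    V (unitOp ρ (k + 1) k (tab C L R)) - unitOp ρ (k + 1) k (V (tab C L R)) =
      (∑ p ∈ rowSet n (k + 1), (φ (R p - 1) * lowerRaise C L R p p -
        φ (R p) * raiseLower C L R p p)) • tab C L R := by
  rw [hV.apply_lower hρ hk hR, hV.lower_apply hρ hk hR, ← sum_sub_distrib, sum_smul]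
  refine sum_congr rfl fun p hp => ?_
  rw [← sum_sub_distrib, sum_eq_single p]
  · rw [← sub_smul, add_sub_cancel_right]
    simp [delta]
  · intro q hq hqp
    have h := hρ.offDiag hk hR hp hq hqp.symm
    -- For `p ≠ q` both orders carry the same factor `φ (R p)`, so the cancellation for `φ = 1`
    -- carries over.
    have h1 : (R - delta q) p = R p := by simp [delta, hqp.symm]
    rw [h1, ← sub_smul, ← mul_sub, mul_smul, h, smul_zero]
  · exact fun h => (h hp).elim

/-- The sum rule that later supplies the subleading coefficient of `nbrPoly`. -/
theorem IsGTAction.sum_diag (hρ : IsGTAction C L ρ) (hk : k + 1 < n) (hR : R ∈ tableaux C L) :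
    ∑ p ∈ rowSet n (k + 1), (lowerRaise C L R p p - raiseLower C L R p p) =
      rowWeight R (k + 1) := by
  have h1 := (hρ.isRaising hk).commutator hρ hk hR
  rw [(hρ.isRaising hk).apply_lower hρ hk hR, (hρ.isRaising hk).lower_apply hρ hk hR] at h1
  have h2 := hρ.sum_smul_tab hk hR
  simp only [one_mul] at h1
  simp_rw [sub_smul, sum_sub_distrib] at h2
  rw [h2] at h1
  have h3 := DFunLike.congr_fun h1 ⟨R, hR⟩
  simpa [tab_apply] using h3.symm

end Action

/-! ### The polynomial of the neighbouring rows and its partial fractions -/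

section RowPolynomial

open Polynomial

variable {n : ℕ} {C : Set (Rel n)} {L R : Tableau n} {ρ : GLAction C L} {k : ℕ}

/-- The positions in the rows next to row `k + 1`. -/
def nbrRows (n k : ℕ) : Finset (Pos n) := rowSet n (k + 2) ∪ rowSet n k

/-- The roots of `nbrPoly`. -/
noncomputable def nbrVal (R : Tableau n) (k : ℕ) (s : Pos n) : ℂ :=
  if s.row = k then R s - 1 else R s

/-- The polynomial with the entries of row `k + 2` and the decreased entries of row `k` as roots. -/
noncomputable def nbrPoly (R : Tableau n) (k : ℕ) : ℂ[X] :=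
  ∏ s ∈ nbrRows n k, (X - Polynomial.C (nbrVal R k s))

/-- Two copies of row `k + 1`. -/
def nodeSet (n k : ℕ) : Finset (Pos n × Bool) := rowSet n (k + 1) ×ˢ univ

/-- The entries of a row, and the entries decreased by one. -/
noncomputable def node (R : Tableau n) (i : Pos n × Bool) : ℂ := if i.2 then R i.1 - 1 else R i.1

/-- The coefficients of the diagonal operators that are composed of `E_{k,k+1}` and `E_{k+1,k}`. -/
noncomputable def nodeCoeff (C : Set (Rel n)) (L R : Tableau n) (i : Pos n × Bool) : ℂ :=
  if i.2 then lowerRaise C L R i.1 i.1 else -raiseLower C L R i.1 i.1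

theorem prod_nbrRows {M : Type*} [CommMonoid M] (R : Tableau n) (k : ℕ) (f : ℂ → M) :
    ∏ s ∈ nbrRows n k, f (nbrVal R k s) =
      (∏ s ∈ rowSet n (k + 2), f (R s)) * ∏ s ∈ rowSet n k, f (R s - 1) := by
  rw [nbrRows, prod_union]
  · congr 1
    · refine prod_congr rfl fun s hs => ?_
      rw [mem_rowSet] at hs
      rw [nbrVal, if_neg (by omega)]
    · refine prod_congr rfl fun s hs => ?_
      rw [mem_rowSet] at hs
      rw [nbrVal, if_pos hs]
  · rw [disjoint_left]
    intro s h1 h2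
    rw [mem_rowSet] at h1 h2
    omega

theorem eval_nbrPoly (x : ℂ) : (nbrPoly R k).eval x =
    (∏ s ∈ rowSet n (k + 2), (x - R s)) * ∏ s ∈ rowSet n k, (x - (R s - 1)) := by
  rw [nbrPoly, eval_prod, ← prod_nbrRows R k (fun y => x - y)]
  simp

theorem card_nbrRows (hk : k + 2 ≤ n) : #(nbrRows n k) = 2 * (k + 1) := by
  rw [nbrRows, card_union_of_disjoint, card_rowSet hk, card_rowSet (by omega)]
  · ring
  · rw [disjoint_left]
    intro s h1 h2
    rw [mem_rowSet] at h1 h2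
    omega

theorem card_nodeSet (hk : k + 1 ≤ n) : #(nodeSet n k) = 2 * (k + 1) := by
  rw [nodeSet, card_product, card_rowSet hk, card_univ, Fintype.card_bool, mul_comm]

theorem mem_nodeSet {i : Pos n × Bool} : i ∈ nodeSet n k ↔ i.1.row = k + 1 := by
  simp [nodeSet, mem_rowSet]

theorem prod_nodeSet_erase {M : Type*} [CommMonoid M] {p : Pos n} (hp : p.row = k + 1) (b : Bool)
    (f : Pos n × Bool → M) : ∏ i ∈ (nodeSet n k).erase (p, b), f i =
      f (p, !b) * ∏ q ∈ (rowSet n (k + 1)).erase p, (f (q, true) * f (q, false)) := by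
  have h : (nodeSet n k).erase (p, b) =
      insert (p, !b) ((rowSet n (k + 1)).erase p ×ˢ univ) := by
    ext ⟨q, c⟩
    simp only [mem_erase, mem_nodeSet, mem_insert, mem_product, mem_rowSet, mem_univ, and_true,
      ne_eq, Prod.mk.injEq]
    by_cases hq : q = p
    · subst hq
      cases b <;> cases c <;> simp [hp]
    · simp [hq]
  rw [h, prod_insert (by simp), prod_product]
  simp

/-- A move out of the basis is blocked by a tight relation with a neighbouring entry, and that entry
supplies a root. Thus reading the missing tableau as `0` agrees with the residue. -/
theorem eval_nbrPoly_eq_zero_of_add_delta (hC : C ⊆ relR n ∪ relR0 n) (hR : R ∈ tableaux C L)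
    (hk : k + 1 < n) {p : Pos n} (hp : p.row = k + 1) (h : R + delta p ∉ tableaux C L) :
    (nbrPoly R k).eval (R p) = 0 := by
  rw [eval_nbrPoly, mul_eq_zero, prod_eq_zero_iff, prod_eq_zero_iff]
  by_contra hne
  push Not at hne
  rw [add_delta_mem_iff hR (by omega)] at h
  refine h (satisfies_add_delta hC hR.2 (by omega) (fun s hs h' => ?_) fun s hs h' => ?_)
  · exact hne.1 s (mem_rowSet.2 (by omega)) (by rw [h', sub_self])
  · exact hne.2 s (mem_rowSet.2 (by omega)) (by rw [h']; ring)

theorem eval_nbrPoly_eq_zero_of_sub_delta (hC : C ⊆ relR n ∪ relR0 n) (hR : R ∈ tableaux C L)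
    (hk : k + 1 < n) {p : Pos n} (hp : p.row = k + 1) (h : R - delta p ∉ tableaux C L) :
    (nbrPoly R k).eval (R p - 1) = 0 := by
  rw [eval_nbrPoly, mul_eq_zero, prod_eq_zero_iff, prod_eq_zero_iff]
  by_contra hne
  push Not at hne
  rw [sub_delta_mem_iff hR (by omega)] at h
  refine h (satisfies_sub_delta hC hR.2 (by omega) (fun s hs h' => ?_) fun s hs h' => ?_)
  · exact hne.2 s (mem_rowSet.2 (by omega)) (by rw [h']; ring)
  · exact hne.1 s (mem_rowSet.2 (by omega)) (by rw [h']; ring)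

theorem Noncritical.prod_ne_zero (h : Noncritical R) {p : Pos n} (hp : p.row < n) :
    ∏ q ∈ (rowSet n p.row).erase p, (R p - R q) ≠ 0 := by
  rw [prod_ne_zero_iff]
  intro q hq
  obtain ⟨hqp, hq⟩ := mem_erase.1 hq
  rw [mem_rowSet] at hq
  exact sub_ne_zero.2 (h p q hq.symm hp hqp.symm)

/-- The residue condition. The numerators of the two Gelfand-Tsetlin coefficients multiply to
`nbrPoly`, and their denominators to the product over the other nodes; the twin node of the same
entry contributes `±1`. -/
theorem nodeCoeff_mul_prod (hC : C ⊆ relR n ∪ relR0 n) (hρ : IsGTAction C L ρ)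
    (hR : R ∈ tableaux C L) (hk : k + 1 < n) {i : Pos n × Bool} (hi : i ∈ nodeSet n k) :
    nodeCoeff C L R i * ∏ j ∈ (nodeSet n k).erase i, (node R i - node R j) =
      (nbrPoly R k).eval (node R i) := by
  obtain ⟨p, b⟩ := i
  have hp := mem_nodeSet.1 hi
  simp only at hp
  rw [prod_nodeSet_erase hp]
  have hD := (hρ.noncritical R hR).prod_ne_zero (p := p) (by omega)
  have hne : ∀ q ∈ (rowSet n (k + 1)).erase p, q ≠ p := fun q hq => (mem_erase.1 hq).1
  cases b with
  | false =>
    simp only [node, nodeCoeff, Bool.not_false, if_true, Bool.false_eq_true, if_false]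
    by_cases h : R + delta p ∈ tableaux C L
    · have hD' := (hρ.noncritical _ h).prod_ne_zero (p := p) (by omega)
      have h1 : ∏ q ∈ (rowSet n (k + 1)).erase p, ((R + delta p) p - (R + delta p) q) =
          ∏ q ∈ (rowSet n (k + 1)).erase p, (R p - (R q - 1)) :=
        prod_congr rfl fun q hq => by simp [delta, hne q hq]; ring
      have h2 : ∏ q ∈ rowSet n k, ((R + delta p) p - (R + delta p) q) =
          ∏ q ∈ rowSet n k, (R p - (R q - 1)) := by
        refine prod_congr rfl fun q hq => ?_
        have : q ≠ p := by rintro rfl; rw [mem_rowSet] at hq; omega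
        simp [delta, this]; ring
      rw [raiseLower, if_pos h, raiseCoeff, lowerCoeff, eval_nbrPoly, prod_mul_distrib]
      rw [hp] at hD hD' ⊢
      rw [Nat.add_sub_cancel, h1, h2]
      rw [h1] at hD'
      field_simp
      ring
    · rw [eval_nbrPoly_eq_zero_of_add_delta hC hR hk hp h, raiseLower, if_neg h]
      simp
  | true =>
    simp only [node, nodeCoeff, Bool.not_true, if_true, Bool.false_eq_true, if_false]
    by_cases h : R - delta p ∈ tableaux C L
    · have hD' := (hρ.noncritical _ h).prod_ne_zero (p := p) (by omega)
      have h1 : ∏ q ∈ (rowSet n (k + 1)).erase p, ((R - delta p) p - (R - delta p) q) =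
          ∏ q ∈ (rowSet n (k + 1)).erase p, (R p - 1 - R q) :=
        prod_congr rfl fun q hq => by simp [delta, hne q hq]
      have h2 : ∏ q ∈ rowSet n (k + 2), ((R - delta p) p - (R - delta p) q) =
          ∏ q ∈ rowSet n (k + 2), (R p - 1 - R q) := by
        refine prod_congr rfl fun q hq => ?_
        have : q ≠ p := by rintro rfl; rw [mem_rowSet] at hq; omega
        simp [delta, this]
      have h3 : ∀ s : Finset (Pos n), ∏ q ∈ s, (R p - 1 - (R q - 1)) = ∏ q ∈ s, (R p - R q) :=
        fun s => prod_congr rfl fun q _ => by ring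
      rw [lowerRaise, if_pos h, raiseCoeff, lowerCoeff, eval_nbrPoly, prod_mul_distrib, h3, h3]
      rw [hp] at hD hD' ⊢
      rw [Nat.add_sub_cancel, h1, h2]
      rw [h1] at hD'
      field_simp
      ring
    · rw [eval_nbrPoly_eq_zero_of_sub_delta hC hR hk hp h, lowerRaise, if_neg h]
      simp

theorem node_collision (hR : Noncritical R) (hk : k + 1 < n) {i j : Pos n × Bool}
    (hi : i ∈ nodeSet n k) (hj : j ∈ nodeSet n k) (hij : i ≠ j) (h : node R i = node R j) :
    (i.2 = false ∧ j.2 = true ∧ R j.1 = R i.1 + 1) ∨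
      (j.2 = false ∧ i.2 = true ∧ R i.1 = R j.1 + 1) := by
  obtain ⟨p, b⟩ := i
  obtain ⟨q, c⟩ := j
  have hp := mem_nodeSet.1 hi
  have hq := mem_nodeSet.1 hj
  simp only at hp hq
  have hnc : R p = R q → p = q := fun h => by
    by_contra hne
    exact hR p q (by omega) (by omega) hne h
  cases b <;> cases c <;> simp [node] at h hij ⊢
  · exact hij (hnc h)
  · rw [h]; ring
  · rw [← h]; ring
  · exact hij (hnc h)

/-- Raising `p` or lowering `q` would make the two entries equal, so neither tableau is in the
basis. -/
theorem nodeCoeff_eq_zero (hρ : IsGTAction C L ρ) (hk : k + 1 < n) {p q : Pos n}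
    (hp : p.row = k + 1) (hq : q.row = k + 1) (h : R q = R p + 1) :
    nodeCoeff C L R (p, false) = 0 ∧ nodeCoeff C L R (q, true) = 0 := by
  have hpq : p ≠ q := by rintro rfl; simp at h
  constructor
  · have : R + delta p ∉ tableaux C L := fun h' =>
      hρ.noncritical _ h' p q (by omega) (by omega) hpq (by simp [delta, hpq.symm, h])
    simp [nodeCoeff, raiseLower, this]
  · have : R - delta q ∉ tableaux C L := fun h' =>
      hρ.noncritical _ h' p q (by omega) (by omega) hpq (by simp [delta, hpq, h])
    simp [nodeCoeff, lowerRaise, this]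

theorem monic_nbrPoly : (nbrPoly R k).Monic := monic_prod_X_sub _ _

theorem natDegree_nbrPoly (hk : k + 2 ≤ n) : (nbrPoly R k).natDegree = #(nodeSet n k) := by
  rw [nbrPoly, natDegree_prod_X_sub, card_nbrRows hk, card_nodeSet (by omega)]

/-- Up to sign, the coefficient on the left is the sum of the roots; the weight in `sum_diag` is
exactly its discrepancy with the sum of the nodes. -/
theorem coeff_nbrPoly (hρ : IsGTAction C L ρ) (hR : R ∈ tableaux C L) (hk : k + 2 ≤ n) :
    (nbrPoly R k).coeff (#(nodeSet n k) - 1) =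
      -∑ i ∈ nodeSet n k, node R i + ∑ i ∈ nodeSet n k, nodeCoeff C L R i := by
  have h1 : ∑ s ∈ nbrRows n k, nbrVal R k s =
      ∑ s ∈ rowSet n (k + 2), R s + ∑ s ∈ rowSet n k, (R s - 1) := by
    -- The additive analogue of `prod_nbrRows`, read off in `Multiplicative ℂ`.
    have := congrArg Multiplicative.toAdd
      (prod_nbrRows R k (fun x => Multiplicative.ofAdd x))
    simpa [toAdd_prod] using this
  have h2 : #(nodeSet n k) = #(nbrRows n k) := by
    rw [card_nbrRows hk, card_nodeSet (by omega)]
  have h3 := hρ.sum_diag (k := k) (by omega) hR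
  rw [rowWeight, sum_sub_distrib] at h3
  rw [h2, nbrPoly, prod_X_sub_C_coeff_card_pred _ _ (by rw [card_nbrRows hk]; omega), h1, nodeSet,
    sum_product, sum_product]
  simp only [node, nodeCoeff, Fintype.sum_bool, if_true, Bool.false_eq_true, if_false,
    sum_add_distrib, sum_sub_distrib, sum_neg_distrib, sum_const, card_rowSet (show k ≤ n by omega),
    card_rowSet (show k + 1 ≤ n by omega)]
  rw [Nat.add_sub_cancel] at h3
  simp only [nsmul_eq_mul, Nat.cast_add, Nat.cast_one, mul_one]
  linear_combination -h3

/-- By noncriticality, `hone` leaves the pair `p, q` as the only source of colliding nodes, so the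
sum rule replaces the one missing interpolation condition. -/
theorem sq_dvd_nbrPoly_of_single (hC : C ⊆ relR n ∪ relR0 n) (hρ : IsGTAction C L ρ)
    (hR : R ∈ tableaux C L) (hk : k + 2 ≤ n) {p q : Pos n} (hp : p.row = k + 1)
    (hq : q.row = k + 1) (h : R q = R p + 1)
    (hone : ∀ p' q' : Pos n, p'.row = k + 1 → q'.row = k + 1 → R q' = R p' + 1 → q' = q) :
    (X - Polynomial.C (R p)) ^ 2 ∣ nbrPoly R k := by
  have hnc := hρ.noncritical R hR
  have hpq : p ≠ q := by rintro rfl; simp at h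
  have h0 := nodeCoeff_eq_zero hρ (by omega) hp hq h
  have := sq_dvd_of_single_collision (I := nodeSet n k) (a := node R) (c := nodeCoeff C L R)
    (i₀ := (p, false)) (j₀ := (q, true)) monic_nbrPoly (natDegree_nbrPoly hk)
    (mem_nodeSet.2 hp) (mem_nodeSet.2 hq) (by simp) (by simp [node, h]) ?_ h0.1 h0.2 ?_ ?_
    (coeff_nbrPoly hρ hR hk)
  · simpa [node] using this
  · rintro ⟨i, b⟩ hi ⟨j, c⟩ hj hij ha
    have hi' := mem_nodeSet.1 hi
    have hj' := mem_nodeSet.1 hj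
    rcases node_collision hnc (by omega) hi hj hij ha with ⟨-, rfl, h3⟩ | ⟨-, rfl, h3⟩
    · exact .inr (Prod.ext (hone _ _ hi' hj' h3) rfl)
    · exact .inl (Prod.ext (hone _ _ hj' hi' h3) rfl)
  · simp only [node, Bool.false_eq_true, if_false]
    refine eval_nbrPoly_eq_zero_of_add_delta hC hR (by omega) hp fun h' => ?_
    exact hρ.noncritical _ h' p q (by omega) (by omega) hpq (by simp [delta, hpq.symm, h])
  · exact fun i hi _ => nodeCoeff_mul_prod hC hρ hR (by omega) hi

theorem exists_pair_of_sq_dvd {ι : Type*} {s : Finset ι} {v : ι → ℂ} {x : ℂ}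
    (h : (X - Polynomial.C x) ^ 2 ∣ ∏ i ∈ s, (X - Polynomial.C (v i))) :
    ∃ i ∈ s, ∃ j ∈ s, i ≠ j ∧ v i = x ∧ v j = x := by
  classical
  have h1 := (le_rootMultiplicity_iff (monic_prod_X_sub s v).ne_zero).2 h
  rw [← count_roots, roots_prod _ _ (monic_prod_X_sub s v).ne_zero] at h1
  simp only [roots_X_sub_C, Multiset.count_bind, Multiset.count_singleton] at h1
  have h2 : 1 < #{i ∈ s | x = v i} := by
    rw [card_filter]
    exact h1
  obtain ⟨i, hi, j, hj, hij⟩ := one_lt_card.1 h2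
  rw [mem_filter] at hi hj
  exact ⟨i, hi.1, j, hj.1, hij, hi.2.symm, hj.2.symm⟩

theorem sq_dvd_of_pair {ι : Type*} {s : Finset ι} {v : ι → ℂ} {x : ℂ} {i j : ι}
    (hi : i ∈ s) (hj : j ∈ s) (hij : i ≠ j) (hvi : v i = x) (hvj : v j = x) :
    (X - Polynomial.C x) ^ 2 ∣ ∏ i ∈ s, (X - Polynomial.C (v i)) := by
  classical
  have := prod_dvd_prod_of_subset {i, j} s (fun k => X - Polynomial.C (v k))
    (by simp [insert_subset_iff, hi, hj])
  rwa [prod_pair hij, hvi, hvj, ← sq] at this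

open Classical in
/-- The number of entries of row `k + 1` other than `q` that are dominated by `v`. -/
noncomputable def domCount (C : Set (Rel n)) (k : ℕ) (q v : Pos n) : ℕ :=
  #{w ∈ rowSet n (k + 1) | w ≠ q ∧ Dominates C v w}

theorem domCount_mono {q a b : Pos n} (h : Dominates C a b) :
    domCount C k q b ≤ domCount C k q a := by
  classical
  exact card_le_card fun w hw => by
    simp only [mem_filter] at hw ⊢
    exact ⟨hw.1, hw.2.1, h.trans hw.2.2⟩

/-- No integer lies strictly between the two entries, so in this row `p` dominates whatever `q`
dominates apart from `q` itself. Hence the deformation by `domCount` keeps the gap of `p` and `q`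
equal to one. -/
theorem IsRealization.domCount_eq (hC : Admissible C) (hR : IsRealization C R) (hk : k + 1 < n)
    {p q : Pos n} (hp : p.row = k + 1) (hq : q.row = k + 1) (h : R q = R p + 1) :
    domCount C k q p = domCount C k q q := by
  classical
  have hpq : q ≠ p := by rintro rfl; simp at h
  have hdom : Dominates C q p :=
    hR.dominates hC (m := 1) (by omega) (by omega) (by simp [h]) hpq
  refine congrArg card (filter_congr fun w hw => and_congr_right fun hwq => ?_)
  rw [mem_rowSet] at hw
  refine ⟨fun h' => hdom.trans h', fun h' => ?_⟩
  by_cases hwp : w = p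
  · exact hwp ▸ .refl
  obtain ⟨m, hm⟩ := h'.sub_nonneg hR.1
  have hm0 : m ≠ 0 := by
    rintro rfl
    exact hR.noncritical hC q w (by omega) (by omega) hwq.symm
      (by simpa [sub_eq_zero] using hm)
  obtain ⟨m, rfl⟩ := Nat.exists_eq_succ_of_ne_zero hm0
  refine hR.dominates hC (m := m) (by omega) (by omega) ?_ (Ne.symm hwp)
  push_cast at hm
  linear_combination hm - h

/-- The deformation widens the gap between a dominating and a dominated entry by at least `K`,
unless the upper one is `q`: any other upper entry counts itself, while the lower one does not count
it. So a gap of one can survive only below `q`. -/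
theorem IsRealization.eq_of_shift_eq (hC : Admissible C) (hR : IsRealization C R) (hk : k + 1 < n)
    {q : Pos n} {K : ℕ} (hK : 0 < K) {p' q' : Pos n} (hp' : p'.row = k + 1)
    (hq' : q'.row = k + 1)
    (h : R q' + (K * domCount C k q q' : ℕ) = R p' + (K * domCount C k q p' : ℕ) + 1) :
    q' = q := by
  classical
  have hne : q' ≠ p' := by rintro rfl; simp at h
  have hne' : R q' ≠ R p' := fun h' => hR.noncritical hC q' p' (by omega) (by omega) hne h'
  set a := domCount C k q q' with ha
  set b := domCount C k q p' with hb
  obtain ⟨d, hdef⟩ : ∃ d : ℤ, d = 1 + K * b - K * a := ⟨_, rfl⟩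
  have hd : R q' - R p' = (d : ℂ) := by
    rw [hdef]
    push_cast at h ⊢
    linear_combination h
  rcases lt_trichotomy d 0 with hlt | heq | hgt
  · obtain ⟨m, hm⟩ := Int.eq_ofNat_of_zero_le (neg_nonneg.2 hlt.le)
    have hdom : Dominates C p' q' := by
      refine hR.dominates hC (m := m) (by omega) (by omega) ?_ hne.symm
      rw [← neg_sub, hd, ← Int.cast_neg, hm, Int.cast_natCast]
    have h1 : K * a ≤ K * b := Nat.mul_le_mul_left K (domCount_mono hdom)
    zify at h1
    omega
  · rw [heq] at hd
    exact (hne' (by simpa [sub_eq_zero] using hd)).elim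
  · obtain ⟨m, hm⟩ := Int.eq_ofNat_of_zero_le hgt.le
    have hdom : Dominates C q' p' := by
      refine hR.dominates hC (m := m) (by omega) (by omega) ?_ hne
      rw [hd, hm, Int.cast_natCast]
    have hle : b ≤ a := domCount_mono hdom
    have hab : a = b := by
      by_contra hab
      have h1 : K * (b + 1) ≤ K * a := Nat.mul_le_mul_left K (by omega)
      rw [mul_add, mul_one] at h1
      zify at h1
      omega
    by_contra hqq
    refine absurd hab (ne_of_gt (card_lt_card ⟨fun w hw => ?_, fun hsub => ?_⟩))
    · simp only [mem_filter] at hw ⊢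
      exact ⟨hw.1, hw.2.1, hdom.trans hw.2.2⟩
    · have := hsub (mem_filter.2 ⟨mem_rowSet.2 hq', hqq, .refl⟩)
      obtain ⟨l, hl⟩ := ((mem_filter.1 this).2.2 : Dominates C p' q').sub_nonneg hR.1
      rw [← neg_sub, hd] at hl
      have h2 : -d = (l : ℤ) := by exact_mod_cast hl
      omega

/-- If two entries of a row differ by one, the polynomial of the neighbouring rows has a double
root. -/
theorem IsRealization.sq_dvd_nbrPoly (hC : Admissible C) (hR : IsRealization C R)
    (hk : k + 2 ≤ n) {p q : Pos n} (hp : p.row = k + 1) (hq : q.row = k + 1)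
    (h : R q = R p + 1) : (X - Polynomial.C (R p)) ^ 2 ∣ nbrPoly R k := by
  -- `K` exceeds all distances from `R p` to the roots of `nbrPoly R k`, so the deformation cannot
  -- create a new coincidence with `R p`.
  obtain ⟨K, hK⟩ := exists_nat_gt (∑ s ∈ nbrRows n k, ‖nbrVal R k s - R p‖)
  have hKpos : 0 < K := by
    have : (0 : ℝ) < K := (sum_nonneg fun s _ => norm_nonneg _).trans_lt hK
    exact_mod_cast this
  have hR' := hR.add_mono (f := fun v => K * domCount C k q v) fun a b hab =>
    Nat.mul_le_mul_left K (domCount_mono (.single hab))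
  obtain ⟨ρ', hρ'⟩ := hC.2 _ hR'
  have heq := hR.domCount_eq hC (by omega) hp hq h
  have h1 := sq_dvd_nbrPoly_of_single hC.1 hρ' (self_mem_tableaux hR'.1) hk hp hq
    (by rw [heq, h]; ring)
    (fun p' q' hp' hq' h' => hR.eq_of_shift_eq hC (by omega) hKpos hp' hq'
      (by rw [h']))
  obtain ⟨i, hi, j, hj, hij, hvi, hvj⟩ := exists_pair_of_sq_dvd h1
  -- A coincidence after the deformation means that the original distance is an integral multiple of
  -- `K`; being smaller than `K`, it is zero. The double root is thus transported back to `R`.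
  have key : ∀ s ∈ nbrRows n k, nbrVal (fun v => R v + (K * domCount C k q v : ℕ)) k s =
      R p + (K * domCount C k q p : ℕ) → nbrVal R k s = R p := by
    intro s hs hv
    have h2 : nbrVal R k s - R p = K * ((domCount C k q p - domCount C k q s : ℤ) : ℂ) := by
      have : nbrVal (fun v => R v + (K * domCount C k q v : ℕ)) k s =
          nbrVal R k s + (K * domCount C k q s : ℕ) := by
        unfold nbrVal
        split_ifs <;> ring
      rw [this] at hv
      push_cast at hv ⊢
      linear_combination hv
    by_contra hne
    have h3 : (domCount C k q p - domCount C k q s : ℤ) ≠ 0 := by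
      intro h0
      rw [h0] at h2
      exact hne (by simpa [sub_eq_zero] using h2)
    have h4 : ‖nbrVal R k s - R p‖ < K :=
      (single_le_sum (f := fun s => ‖nbrVal R k s - R p‖) (fun _ _ => norm_nonneg _) hs).trans_lt hK
    rw [h2, norm_mul, Complex.norm_natCast, Complex.norm_intCast] at h4
    have h5 : (1 : ℝ) ≤ |((domCount C k q p - domCount C k q s : ℤ) : ℝ)| := by
      exact_mod_cast Int.one_le_abs h3
    nlinarith [(Nat.cast_pos (α := ℝ)).2 hKpos]
  exact sq_dvd_of_pair hi hj hij (key i hi hvi) (key j hj hvj)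

/-- The partial fraction decomposition of the polynomial of the neighbouring rows. -/
theorem nbrPoly_eq_partialFrac (hC : Admissible C) (hL : IsRealization C L)
    (hρ : IsGTAction C L ρ) (hR : R ∈ tableaux C L) (hk : k + 2 ≤ n) :
    nbrPoly R k = partialFrac (nodeSet n k) (node R) (nodeCoeff C L R) := by
  have hR' := hL.of_intShift (intShift_of_mem hR) hR.2
  have hnc := hρ.noncritical R hR
  refine eq_partialFrac monic_nbrPoly (natDegree_nbrPoly hk)
    (fun i hi _ => nodeCoeff_mul_prod hC.1 hρ hR (by omega) hi) ?_ fun x => ?_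
  · rintro ⟨i, b⟩ hi ⟨j, c⟩ hj hij ha
    have hi' := mem_nodeSet.1 hi
    have hj' := mem_nodeSet.1 hj
    rcases node_collision hnc (by omega) hi hj hij ha with ⟨hb, hc, h3⟩ | ⟨hc, hb, h3⟩ <;>
      simp only at hb hc h3 hi' hj' <;> subst hb <;> subst hc
    · exact ⟨(nodeCoeff_eq_zero hρ (by omega) hi' hj' h3).1, by
        simpa [node] using hR'.sq_dvd_nbrPoly hC hk hi' hj' h3⟩
    · exact ⟨(nodeCoeff_eq_zero hρ (by omega) hj' hi' h3).2, by
        simpa [node, h3] using hR'.sq_dvd_nbrPoly hC hk hj' hi' h3⟩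
  -- Equal nodes with the same flag belong to equal entries of a noncritical row, so each flag
  -- occurs at most once.
  · refine (card_le_card_of_injOn (t := (univ : Finset Bool)) Prod.snd (fun _ _ => mem_univ _)
      fun i hi j hj hij => ?_).trans_eq (by simp)
    rw [mem_coe, mem_filter] at hi hj
    by_contra hne
    rcases node_collision hnc (by omega) hi.1 hj.1 hne (hi.2.trans hj.2.symm) with
      ⟨hb, hc, -⟩ | ⟨hc, hb, -⟩ <;> rw [hb, hc] at hij <;> simp at hij

end RowPolynomial

/-! ### Resolvents, Schur complements and traces evaluated on tableaux -/

section Level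

variable {n : ℕ} {C : Set (Rel n)} {L R : Tableau n} {ρ : GLAction C L} {N : ℕ} {u : ℂ}

/-- `u` does not differ from an entry of `L` by an integer. -/
def Generic (L : Tableau n) (u : ℂ) : Prop := ∀ p, ∀ m : ℤ, u ≠ L p + m

theorem Generic.add_int (h : Generic L u) (k : ℤ) : Generic L (u + k) := by
  intro p m hm
  refine h p (m - k) ?_
  push_cast
  linear_combination hm

theorem Generic.sub_ne_zero (h : Generic L u) (hR : R ∈ tableaux C L) (p : Pos n) :
    u - R p ≠ 0 := by
  obtain ⟨⟨z, -, hz⟩, -⟩ := hR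
  rw [hz p]
  exact _root_.sub_ne_zero.2 (h p (z p))

/-- The polynomial with the entries of row `k` as roots, evaluated at `w`. -/
noncomputable def rowEval (R : Tableau n) (k : ℕ) (w : ℂ) : ℂ := ∏ p ∈ rowSet n k, (w - R p)

theorem Generic.rowEval_ne_zero (h : Generic L u) (hR : R ∈ tableaux C L) (k : ℕ) :
    rowEval R k u ≠ 0 :=
  prod_ne_zero_iff.2 fun p _ => h.sub_ne_zero hR p

theorem rowSet_zero : rowSet n 0 = ∅ := by
  rw [← card_eq_zero, card_rowSet (Nat.zero_le n)]

theorem rowEval_zero (R : Tableau n) (w : ℂ) : rowEval R 0 w = 1 := by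
  rw [rowEval, rowSet_zero, prod_empty]

theorem rowEval_add_delta {k : ℕ} {p : Pos n} (hp : p ∈ rowSet n k) (w : ℂ) :
    rowEval (R + delta p) k w * (w - R p) = rowEval R k w * (w - R p - 1) := by
  rw [rowEval, rowEval, ← mul_prod_erase _ _ hp, ← mul_prod_erase _ _ hp]
  have h : ∏ q ∈ (rowSet n k).erase p, (w - (R + delta p) q) =
      ∏ q ∈ (rowSet n k).erase p, (w - R q) :=
    prod_congr rfl fun q hq => by simp [delta, (mem_erase.1 hq).1]
  rw [h]
  simp [delta]
  ring

theorem rowEval_add_delta_of_ne {k : ℕ} {p : Pos n} (hp : p.row ≠ k) (w : ℂ) :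
    rowEval (R + delta p) k w = rowEval R k w := by
  refine prod_congr rfl fun q hq => ?_
  have : q ≠ p := by rintro rfl; exact hp (mem_rowSet.1 hq)
  simp [delta, this]

/-- The operator that is diagonal in the basis of tableaux. -/
noncomputable def diagOp (C : Set (Rel n)) (L : Tableau n) (f : Tableau n → ℂ) :
    Module.End ℂ (TabSpace C L) :=
  Finsupp.linearCombination ℂ fun T : tableaux C L => f T • tab C L T

theorem diagOp_tab (f : Tableau n → ℂ) (hR : R ∈ tableaux C L) :
    diagOp C L f (tab C L R) = f R • tab C L R := by
  conv_lhs => rw [tab_of_mem hR]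
  rw [diagOp, Finsupp.linearCombination_single, one_smul]

/-- The resolvents of the blocks of the matrix of matrix units. -/
noncomputable def resolv (ρ : GLAction C L) : ℕ → ℂ → ℕ → ℕ → Module.End ℂ (TabSpace C L)
  | 0, _ => 0
  | N + 1, u => blockInv (unitOp ρ) N (resolv ρ N u)
      (diagOp C L fun R => rowEval R N (u - N) / rowEval R (N + 1) (u - N))

/-- The action of the last diagonal entry of the resolvent. -/
def LastEntry (C : Set (Rel n)) (L : Tableau n) (N : ℕ) (u : ℂ)
    (t : ℕ → ℕ → Module.End ℂ (TabSpace C L)) : Prop :=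
  ∀ m, N = m + 1 → ∀ R ∈ tableaux C L,
    t m m (tab C L R) = (rowEval R m (u - m) / rowEval R (m + 1) (u - m)) • tab C L R

variable {t : ℕ → ℕ → Module.End ℂ (TabSpace C L)}

theorem Generic.sub_nat (h : Generic L u) (k : ℕ) : Generic L (u - k) := by
  have := h.add_int (-k)
  push_cast at this
  rwa [← sub_eq_add_neg] at this

/-- By `comm_vectorOp` one has `V t_mm = [t_mm, X]`, where `V` is the last entry of the product and
`X` is the raising generator. As `t_mm` is diagonal, `V` multiplies each coefficient of `X` by the
relative change of its eigenvalue. -/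
theorem isRaising_mulCol {m : ℕ} (hρ : IsGTAction C L ρ) (hm : m + 1 < n) (hu : Generic L u)
    (ht : IsResolvent (unitOp ρ) (m + 1) u t) (hlast : LastEntry C L (m + 1) u t) :
    IsRaising C L (m + 1) (fun x => (u - (m + 1 : ℕ) - x)⁻¹)
      (mulCol (m + 1) t (fun i => unitOp ρ i (m + 1)) m) := by
  intro R hR
  have h1 := ht.comm_vectorOp (vectorOp_lastCol (glRel_unitOp ρ) hm) (Nat.lt_succ_self m)
    (Nat.lt_succ_self m) (Nat.lt_succ_self m)
  set V := mulCol (m + 1) t (fun i => unitOp ρ i (m + 1)) m with hV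
  have h2 := LinearMap.congr_fun h1 (tab C L R)
  have hX := hρ.isRaising hm R hR
  simp only [one_mul] at hX
  simp only [LinearMap.sub_apply, Module.End.mul_apply] at h2
  have hg := hu.sub_nat m
  have hg' := hu.sub_nat (m + 1)
  have hn1 := hg.rowEval_ne_zero hR m
  have hn2 := hg.rowEval_ne_zero hR (m + 1)
  rw [hlast m rfl R hR, map_smul, map_smul, hX, map_sum, smul_sum, ← sum_sub_distrib] at h2
  rw [← smul_right_injective _ (div_ne_zero hn1 hn2) |>.eq_iff]
  refine h2.symm.trans ?_
  rw [smul_sum]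
  refine sum_congr rfl fun p hp => ?_
  rw [map_smul]
  by_cases h : R + delta p ∈ tableaux C L
  · rw [hlast m rfl _ h, smul_smul, smul_smul, smul_smul, ← sub_smul]
    congr 1
    have hrow := mem_rowSet.1 hp
    rw [rowEval_add_delta_of_ne (by omega)]
    have h3 := rowEval_add_delta (R := R) hp (u - m)
    have h4 := hg.rowEval_ne_zero h (m + 1)
    have h5 := hg.sub_ne_zero hR p
    have h6 := hg'.sub_ne_zero hR p
    have h7 : u - (m + 1 : ℕ) - R p = u - m - R p - 1 := by push_cast; ring
    beta_reduce
    rw [h7] at h6 ⊢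
    have h8 : rowEval (R + delta p) (m + 1) (u - m) =
        rowEval R (m + 1) (u - m) * (u - m - R p - 1) / (u - m - R p) := by
      rw [← h3]; field_simp
    rw [h8]
    field_simp
    ring
  · rw [tab_of_notMem h]
    simp

theorem eval_partialFrac_of_ne {ι : Type*} [DecidableEq ι] (I : Finset ι) (a c : ι → ℂ) {y : ℂ}
    (hy : ∀ i ∈ I, y - a i ≠ 0) : (partialFrac I a c).eval y =
      (∏ i ∈ I, (y - a i)) * (1 + ∑ i ∈ I, c i * (y - a i)⁻¹) := by
  simp only [partialFrac, Polynomial.eval_add, Polynomial.eval_prod, Polynomial.eval_sub,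
    Polynomial.eval_X, Polynomial.eval_C, Polynomial.eval_finsetSum, Polynomial.eval_mul, mul_add,
    mul_one, mul_sum]
  congr 1
  refine sum_congr rfl fun i hi => ?_
  rw [← mul_prod_erase _ _ hi]
  have := hy i hi
  field_simp

/-- In `[V, e_{N,N-1}] = S t_mm - 1` with `m = N - 1`, the left side is the diagonal sum of
`IsRaising.commutator`. Together with the `1` it is `partialFrac` at `u - N` divided by the product
over the nodes, so `nbrPoly_eq_partialFrac` evaluates it. Dividing by the eigenvalue of `t_mm`
leaves the ratio of two consecutive rows. -/
theorem schur_tab (hC : Admissible C) (hL : IsRealization C L) (hρ : IsGTAction C L ρ) (hN : N < n)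
    (hu : Generic L u) (ht : IsResolvent (unitOp ρ) N u t) (hlast : LastEntry C L N u t) :
    schur (unitOp ρ) N u t =
      diagOp C L fun R => rowEval R (N + 1) (u - N) / rowEval R N (u - N) := by
  refine ext_tab fun R hR => ?_
  rw [diagOp_tab _ hR]
  rcases N with _ | m
  · obtain ⟨p, hp⟩ := card_eq_one.1 (card_rowSet (n := n) (k := 1) (by omega))
    have h1 := hρ.diag R hR 1 le_rfl (by omega)
    have h2 : unitOp ρ 0 0 (tab C L R) = R p • tab C L R := by
      rw [unitOp, h1, hp]
      simp [rowSet_zero]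
    simp [schur, h2, rowEval, rowSet_zero, hp, sub_smul]
  · have hn1 := (hu.sub_nat m).rowEval_ne_zero hR m
    have hn2 := (hu.sub_nat m).rowEval_ne_zero hR (m + 1)
    have hn3 := (hu.sub_nat (m + 1)).rowEval_ne_zero hR (m + 1)
    have hV := (isRaising_mulCol hρ hN hu ht hlast).commutator hρ hN hR
    have h1 := ht.comm_col_row (glRel_unitOp ρ) hN (Nat.lt_succ_self m) (Nat.lt_succ_self m)
    rw [ht.comm_of_comm (fun i hi j hj => ht.comm_schur (glRel_unitOp ρ) hN hi hj)
      (Nat.lt_succ_self m) (Nat.lt_succ_self m), if_pos rfl] at h1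
    have h2 := LinearMap.congr_fun h1 (tab C L R)
    simp only [LinearMap.sub_apply, Module.End.mul_apply, Module.End.one_apply] at h2
    rw [hV, hlast m rfl R hR, map_smul, eq_sub_iff_add_eq] at h2
    have h3 : nbrPoly R m = _ := nbrPoly_eq_partialFrac hC hL hρ hR (by omega)
    have h4 := congrArg (Polynomial.eval (u - (m + 1 : ℕ))) h3
    have hgen := hu.sub_nat (m + 1)
    have hgen' := hu.sub_nat m
    have hcast : u - (m + 1 : ℕ) + 1 = u - m := by push_cast; ring
    rw [eval_nbrPoly, eval_partialFrac_of_ne, nodeSet, prod_product, sum_product] at h4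
    · simp only [Fintype.prod_bool, Fintype.sum_bool, node, nodeCoeff, if_true, Bool.false_eq_true,
        if_false, prod_mul_distrib] at h4
      have h5 : ∀ s : Finset (Pos n), ∏ q ∈ s, (u - (m + 1 : ℕ) - (R q - 1)) =
          ∏ q ∈ s, (u - m - R q) := fun s => prod_congr rfl fun q _ => by rw [← hcast]; ring
      rw [h5, h5] at h4
      change rowEval R (m + 2) _ * rowEval R m _ =
        rowEval R (m + 1) _ * rowEval R (m + 1) _ * _ at h4
      have h6 : ∑ p ∈ rowSet n (m + 1),
          ((u - (m + 1 : ℕ) - (R p - 1))⁻¹ * lowerRaise C L R p p -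
            (u - (m + 1 : ℕ) - R p)⁻¹ * raiseLower C L R p p) =
          ∑ p ∈ rowSet n (m + 1), (lowerRaise C L R p p * (u - (m + 1 : ℕ) - (R p - 1))⁻¹ +
            -raiseLower C L R p p * (u - (m + 1 : ℕ) - R p)⁻¹) :=
        sum_congr rfl fun p _ => by ring
      rw [h6] at h2
      set S := ∑ p ∈ rowSet n (m + 1), (lowerRaise C L R p p * (u - (m + 1 : ℕ) - (R p - 1))⁻¹ +
            -raiseLower C L R p p * (u - (m + 1 : ℕ) - R p)⁻¹) with hS
      rw [← smul_right_injective _ (div_ne_zero hn1 hn2) |>.eq_iff]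
      refine h2.symm.trans ?_
      rw [smul_smul]
      nth_rw 2 [← one_smul ℂ (tab C L R)]
      rw [← add_smul]
      congr 1
      field_simp
      linear_combination -h4
    · intro i _
      rw [node]
      split_ifs
      · have := hgen'.sub_ne_zero hR i.1
        rw [← hcast] at this
        rwa [sub_sub_eq_add_sub, sub_add_eq_add_sub] at *
      · exact hgen.sub_ne_zero hR i.1

theorem diagOp_mul (f g : Tableau n → ℂ) :
    diagOp C L f * diagOp C L g = diagOp C L fun R => f R * g R := by
  refine ext_tab fun R hR => ?_
  rw [Module.End.mul_apply, diagOp_tab _ hR, map_smul, diagOp_tab _ hR, diagOp_tab _ hR, smul_smul,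
    mul_comm]

theorem diagOp_eq_one {f : Tableau n → ℂ} (h : ∀ R ∈ tableaux C L, f R = 1) :
    diagOp C L f = 1 := by
  refine ext_tab fun R hR => ?_
  rw [diagOp_tab _ hR, h R hR, one_smul, Module.End.one_apply]

/-- The diagonal operator put into `resolv` is justified row by row: the last entry at level `N`
gives the Schur complement there, which the prescribed operator inverts. -/
theorem resolv_spec (hC : Admissible C) (hL : IsRealization C L) (hρ : IsGTAction C L ρ) (hN : N ≤ n)
    (hu : Generic L u) :
    IsResolvent (unitOp ρ) N u (resolv ρ N u) ∧ LastEntry C L N u (resolv ρ N u) := by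
  induction N with
  | zero => exact ⟨⟨fun i hi => by omega, fun i hi => by omega⟩, fun m hm => by omega⟩
  | succ N ih =>
    obtain ⟨ht, hlast⟩ := ih (by omega)
    have hS := schur_tab hC hL hρ hN hu ht hlast
    have hne := fun R (hR : R ∈ tableaux C L) k => (hu.sub_nat N).rowEval_ne_zero hR k
    constructor
    · refine ht.isResolvent_blockInv ?_ ?_ <;> rw [hS, diagOp_mul] <;>
        refine diagOp_eq_one fun R hR => ?_ <;> have := hne R hR N <;>
          have := hne R hR (N + 1) <;> field_simp
    · rintro m hm R hR
      obtain rfl : N = m := by omega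
      rw [resolv, blockInv_last, diagOp_tab _ hR]

theorem schur_resolv (hC : Admissible C) (hL : IsRealization C L) (hρ : IsGTAction C L ρ)
    (hN : N < n) (hu : Generic L u) : schur (unitOp ρ) N u (resolv ρ N u) =
      diagOp C L fun R => rowEval R (N + 1) (u - N) / rowEval R N (u - N) :=
  have h := resolv_spec hC hL hρ hN.le hu
  schur_tab hC hL hρ hN hu h.1 h.2

theorem commutator_mul_eq {A : Type*} [Ring A] {x y e s : A} (h : x * s = s * y)
    (he : e * s = s * e) : (e * x - x * e) * s = s * (e * y - y * e) := by
  rw [sub_mul, mul_sub, mul_assoc, mul_assoc, h, he, ← mul_assoc, ← mul_assoc, h, he, mul_assoc,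
    mul_assoc]

/-- For the last entry both sides are explicit raising operators. The other entries are its
commutators with `e_{l,N-1}`, and these commute with the Schur complement. -/
theorem mulCol_mul_schur (hC : Admissible C) (hL : IsRealization C L) (hρ : IsGTAction C L ρ)
    (hN : N < n) (hu : Generic L u) {l : ℕ} (hl : l < N) :
    mulCol N (resolv ρ N (u - 1)) (fun i => unitOp ρ i N) l *
        schur (unitOp ρ) N u (resolv ρ N u) =
      schur (unitOp ρ) N u (resolv ρ N u) * mulCol N (resolv ρ N u) (fun i => unitOp ρ i N) l := by
  obtain ⟨m, rfl⟩ : ∃ m, N = m + 1 := ⟨N - 1, by omega⟩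
  have hu₁ : Generic L (u - 1) := by simpa using hu.sub_nat 1
  obtain ⟨ht, hlast⟩ := resolv_spec hC hL hρ hN.le hu
  obtain ⟨ht₁, hlast₁⟩ := resolv_spec hC hL hρ hN.le hu₁
  have hV := isRaising_mulCol hρ hN hu ht hlast
  have hV₁ := isRaising_mulCol hρ hN hu₁ ht₁ hlast₁
  have hc := ht.vectorOp (glRel_unitOp ρ) hN.le (vectorOp_lastCol (glRel_unitOp ρ) hN)
  have hc₁ := ht₁.vectorOp (glRel_unitOp ρ) hN.le (vectorOp_lastCol (glRel_unitOp ρ) hN)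
  have hS := fun i hi => ht.comm_schur (i := l) (j := i) (glRel_unitOp ρ) hN hl hi
  have hSd := schur_resolv hC hL hρ hN hu
  set V := mulCol (m + 1) (resolv ρ (m + 1) u) (fun i => unitOp ρ i (m + 1))
  set V₁ := mulCol (m + 1) (resolv ρ (m + 1) (u - 1)) (fun i => unitOp ρ i (m + 1))
  set S := schur (unitOp ρ) (m + 1) u (resolv ρ (m + 1) u)
  have hlastcol : V₁ m * S = S * V m := by
    rw [hSd]
    refine ext_tab fun R hR => ?_
    rw [Module.End.mul_apply, Module.End.mul_apply, diagOp_tab _ hR, map_smul, hV R hR, hV₁ R hR,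
      map_sum, smul_sum]
    refine sum_congr rfl fun p hp => ?_
    rw [map_smul]
    by_cases h : R + delta p ∈ tableaux C L
    · rw [diagOp_tab _ h, smul_smul, smul_smul]
      congr 1
      have hrow := mem_rowSet.1 hp
      have hg := hu.sub_nat (m + 1)
      have hg₁ := hu₁.sub_nat (m + 1)
      rw [rowEval_add_delta_of_ne (by omega)]
      have h3 := rowEval_add_delta (R := R) hp (u - (m + 1 : ℕ))
      have h4 := hg.rowEval_ne_zero h (m + 1)
      have h4' := hg.rowEval_ne_zero hR (m + 1)
      have h5 := hg.sub_ne_zero hR p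
      have h6 := hg₁.sub_ne_zero hR p
      have h7 : u - 1 - (m + 1 : ℕ) - R p = u - (m + 1 : ℕ) - R p - 1 := by ring
      beta_reduce
      rw [h7] at h6 ⊢
      field_simp
      linear_combination (rowEval R (m + 1 + 1) (u - (m + 1 : ℕ))) * raiseCoeff R p * h3
    · rw [tab_of_notMem h]
      simp
  rcases Nat.lt_succ_iff_lt_or_eq.1 hl with hlm | rfl
  · have h1 := hc l hl m (Nat.lt_succ_self m) m (Nat.lt_succ_self m)
    have h2 := hc₁ l hl m (Nat.lt_succ_self m) m (Nat.lt_succ_self m)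
    rw [if_pos rfl] at h1 h2
    have h3 := hS m (Nat.lt_succ_self m)
    rw [← h1, ← h2]
    exact commutator_mul_eq hlastcol h3
  · exact hlastcol

/-- Each step of `trace_blockInv` multiplies by `S(u)⁻¹ S(u - 1)` and passes to `u - 1` in the
smaller block, so the row ratios telescope. -/
theorem one_sub_trace_resolv (hC : Admissible C) (hL : IsRealization C L) (hρ : IsGTAction C L ρ)
    (hN : N ≤ n) (hu : Generic L u) : 1 - ∑ a ∈ range N, resolv ρ N u a a =
      diagOp C L fun R => rowEval R N (u - N) / rowEval R N (u - N + 1) := by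
  induction N generalizing u with
  | zero =>
    rw [diagOp_eq_one fun R _ => by simp [rowEval_zero]]
    rw [sum_range_zero]
    exact sub_zero (1 : Module.End ℂ (TabSpace C L))
  | succ N ih =>
    have hu₁ : Generic L (u - 1) := by simpa using hu.sub_nat 1
    have ht := (resolv_spec hC hL hρ (Nat.le_of_succ_le hN) hu).1
    have ht₁ := (resolv_spec hC hL hρ (Nat.le_of_succ_le hN) hu₁).1
    have hS := schur_resolv hC hL hρ hN hu
    have hS₁ := schur_resolv hC hL hρ hN hu₁
    have hne := fun R (hR : R ∈ tableaux C L) k => (hu.sub_nat N).rowEval_ne_zero hR k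
    have hne₁ := fun R (hR : R ∈ tableaux C L) k => (hu₁.sub_nat N).rowEval_ne_zero hR k
    have h := ht.trace_blockInv ht₁ (glRel_unitOp ρ) hN
      (Z := diagOp C L fun R => rowEval R N (u - N) / rowEval R (N + 1) (u - N))
      (by rw [hS, diagOp_mul]
          refine diagOp_eq_one fun R hR => ?_
          have := hne R hR N
          have := hne R hR (N + 1)
          field_simp)
      (by rw [hS, diagOp_mul]
          refine diagOp_eq_one fun R hR => ?_
          have := hne R hR N
          have := hne R hR (N + 1)
          field_simp)
      (fun l hl => mulCol_mul_schur hC hL hρ hN hu hl)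
    rw [resolv, h, ih (Nat.le_of_succ_le hN) hu₁, hS₁, diagOp_mul, diagOp_mul]
    refine ext_tab fun R hR => ?_
    rw [diagOp_tab _ hR, diagOp_tab _ hR]
    congr 1
    have h1 := hne R hR N
    have h2 := hne R hR (N + 1)
    have h3 := hne₁ R hR N
    have h4 : u - 1 - N + 1 = u - N := by ring
    have h5 : u - (N + 1 : ℕ) = u - 1 - N := by push_cast; ring
    rw [h5, h4]
    field_simp

end Level

open Filter Topology

/-! ### Sequences of vectors and operators tending to zero -/

section Decay

variable {M M' : Type*} [AddCommGroup M] [Module ℂ M] [AddCommGroup M'] [Module ℂ M']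

/-- The sequences of vectors that stay in a subspace of finite dimension and tend to zero. -/
def Decay (M : Type*) [AddCommGroup M] [Module ℂ M] : Submodule ℂ (ℕ → M) :=
  Submodule.span ℂ {f | ∃ φ : ℕ → ℂ, ∃ w, Tendsto φ atTop (𝓝 0) ∧ f = fun j => φ j • w}

theorem smul_mem_decay {φ : ℕ → ℂ} (hφ : Tendsto φ atTop (𝓝 0)) (w : M) :
    (fun j => φ j • w) ∈ Decay M :=
  Submodule.subset_span ⟨φ, w, hφ, rfl⟩

theorem apply_mem_decay {g : ℕ → M →ₗ[ℂ] M'}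
    (hg : ∀ φ : ℕ → ℂ, Tendsto φ atTop (𝓝 0) → ∀ w, (fun j => φ j • g j w) ∈ Decay M')
    {f : ℕ → M} (hf : f ∈ Decay M) : (fun j => g j (f j)) ∈ Decay M' := by
  induction hf using Submodule.span_induction with
  | mem f hf =>
    obtain ⟨φ, w, hφ, rfl⟩ := hf
    simpa using hg φ hφ w
  | zero =>
    simp only [Pi.zero_apply, map_zero]
    exact (Decay M').zero_mem
  | add f f' _ _ h h' =>
    simp only [Pi.add_apply, map_add]
    exact (Decay M').add_mem h h'
  | smul c f _ h =>
    simp only [Pi.smul_apply, map_smul]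
    exact (Decay M').smul_mem c h

theorem map_mem_decay {f : ℕ → M} (hf : f ∈ Decay M) (g : M →ₗ[ℂ] M') :
    (fun j => g (f j)) ∈ Decay M' :=
  apply_mem_decay (fun _ hφ w => smul_mem_decay hφ (g w)) hf

theorem tendsto_of_mem_decay {f : ℕ → M} (hf : f ∈ Decay M) (g : M →ₗ[ℂ] ℂ) :
    Tendsto (fun j => g (f j)) atTop (𝓝 0) := by
  induction hf using Submodule.span_induction with
  | mem f hf =>
    obtain ⟨φ, w, hφ, rfl⟩ := hf
    simpa using hφ.mul_const (g w)
  | zero => simp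
  | add f f' _ _ h h' => simpa using h.add h'
  | smul c f _ h => simpa using h.const_mul c

theorem smul_decay_mem {φ : ℕ → ℂ} (hφ : Tendsto φ atTop (𝓝 0)) {f : ℕ → M} (hf : f ∈ Decay M) :
    (fun j => φ j • f j) ∈ Decay M := by
  refine apply_mem_decay (g := fun j => φ j • LinearMap.id) (fun ψ hψ w => ?_) hf
  simp only [LinearMap.smul_apply, LinearMap.id_apply, smul_smul]
  exact smul_mem_decay (by simpa using hψ.mul hφ) w

/-- The sequences of operators that send every vector to a sequence in `Decay M`. -/
def DecayOp (f : ℕ → Module.End ℂ M) : Prop := ∀ v, (fun j => f j v) ∈ Decay M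

variable {f g : ℕ → Module.End ℂ M}

theorem DecayOp.add (hf : DecayOp f) (hg : DecayOp g) : DecayOp fun j => f j + g j :=
  fun v => (Decay M).add_mem (hf v) (hg v)

theorem DecayOp.zero : DecayOp fun _ => (0 : Module.End ℂ M) := fun _ => (Decay M).zero_mem

theorem DecayOp.sum {ι : Type*} {s : Finset ι} {f : ι → ℕ → Module.End ℂ M}
    (h : ∀ i ∈ s, DecayOp (f i)) : DecayOp fun j => ∑ i ∈ s, f i j := by
  intro v
  simp only [LinearMap.sum_apply]
  have := (Decay M).sum_mem fun i hi => h i hi v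
  convert this using 1
  ext j
  simp

theorem DecayOp.mul_const (hf : DecayOp f) (a : Module.End ℂ M) : DecayOp fun j => f j * a :=
  fun v => hf (a v)

theorem DecayOp.const_mul (hf : DecayOp f) (a : Module.End ℂ M) : DecayOp fun j => a * f j :=
  fun v => map_mem_decay (hf v) a

/-- This is where finite-dimensionality in `Decay` is needed: a varying operator meets only finitely
many vectors, with scalar factors tending to zero. Convergence of coordinates alone would not
survive composition. -/
theorem DecayOp.apply (hf : DecayOp f) {v : ℕ → M} (hv : v ∈ Decay M) :
    (fun j => f j (v j)) ∈ Decay M :=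
  apply_mem_decay (fun _ hφ w => smul_decay_mem hφ (hf w)) hv

theorem DecayOp.mul (hf : DecayOp f) (hg : DecayOp g) : DecayOp fun j => f j * g j :=
  fun v => hf.apply (hg v)

end Decay

/-! ### Decay of the resolvents -/

section Level

variable {n : ℕ} {C : Set (Rel n)} {L R R' : Tableau n} {ρ : GLAction C L} {N k : ℕ} {u : ℂ}

theorem tendsto_rowEval (hk : k ≤ n) (R : Tableau n) (a : ℂ) :
    Tendsto (fun j : ℕ => rowEval R k (a + j) / ((j : ℂ) + 1) ^ k) atTop (𝓝 1) := by
  have h : ∀ j : ℕ, rowEval R k (a + j) / ((j : ℂ) + 1) ^ k =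
      ∏ p ∈ rowSet n k, (1 + (a - R p - 1) * (1 / ((j : ℂ) + 1))) := by
    intro j
    have hj : (j : ℂ) + 1 ≠ 0 := Nat.cast_add_one_ne_zero j
    have h1 : ((j : ℂ) + 1) ^ k = ∏ p ∈ rowSet n k, ((j : ℂ) + 1) := by
      rw [prod_const, card_rowSet hk]
    rw [h1, rowEval, ← prod_div_distrib]
    refine prod_congr rfl fun p _ => ?_
    field_simp
    ring
  simp_rw [h]
  rw [← prod_const_one (s := rowSet n k)]
  refine tendsto_finsetProd _ fun p _ => ?_
  have h1 : Tendsto (fun j : ℕ => 1 / ((j : ℂ) + 1)) atTop (𝓝 0) :=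
    tendsto_one_div_add_atTop_nhds_zero_nat
  simpa using (h1.const_mul (a - R p - 1)).const_add 1

theorem tendsto_rowEval_div (hk : k ≤ n) (R R' : Tableau n) (a b : ℂ) :
    Tendsto (fun j : ℕ => rowEval R k (a + j) / rowEval R' k (b + j)) atTop (𝓝 1) := by
  have h := (tendsto_rowEval hk R a).div (tendsto_rowEval hk R' b) one_ne_zero
  rw [div_one] at h
  refine h.congr fun j => ?_
  have hj : (j : ℂ) + 1 ≠ 0 := Nat.cast_add_one_ne_zero j
  exact div_div_div_cancel_right₀ (pow_ne_zero k hj) _ _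

theorem tendsto_rowEval_div_succ (hk : k + 1 ≤ n) (R : Tableau n) (a : ℂ) :
    Tendsto (fun j : ℕ => rowEval R k (a + j) / rowEval R (k + 1) (a + j)) atTop (𝓝 0) := by
  have h := (tendsto_rowEval (Nat.le_of_succ_le hk) R a).div (tendsto_rowEval hk R a) one_ne_zero
  have h1 : Tendsto (fun j : ℕ => 1 / ((j : ℂ) + 1)) atTop (𝓝 0) :=
    tendsto_one_div_add_atTop_nhds_zero_nat
  have h2 := h.mul h1
  rw [mul_zero] at h2
  refine h2.congr fun j => ?_
  have hj : (j : ℂ) + 1 ≠ 0 := Nat.cast_add_one_ne_zero j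
  simp only [Pi.div_apply]
  rw [pow_succ]
  field_simp

theorem DecayOp.of_tab {f : ℕ → Module.End ℂ (TabSpace C L)}
    (h : ∀ R ∈ tableaux C L, (fun j => f j (tab C L R)) ∈ Decay (TabSpace C L)) : DecayOp f := by
  intro v
  induction v using Finsupp.induction_linear with
  | zero =>
    simp only [map_zero]
    exact (Decay _).zero_mem
  | add v w hv hw =>
    simp only [map_add]
    exact (Decay _).add_mem hv hw
  | single T c =>
    have := (Decay _).smul_mem c (h T T.2)
    rw [tab_of_mem T.2] at this
    convert this using 1
    ext1 j
    rw [Pi.smul_apply, ← map_smul, Finsupp.smul_single, smul_eq_mul, mul_one]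

theorem Generic.add_nat (h : Generic L u) (k : ℕ) : Generic L (u + k) := by
  simpa using h.add_int k

theorem exists_generic (L : Tableau n) : ∃ u, Generic L u := by
  refine ⟨(1 + ∑ p, |(L p).im| : ℝ) * Complex.I, fun p m h => ?_⟩
  have h1 := congrArg Complex.im h
  simp only [Complex.im_ofReal_mul, Complex.I_im, mul_one, Complex.add_im, Complex.intCast_im,
    add_zero] at h1
  have h2 := single_le_sum (f := fun p => |(L p).im|) (fun q _ => abs_nonneg _) (mem_univ p)
  have h3 := le_abs_self (L p).im
  linarith

/-- The resolvents tend to zero along `u, u + 1, u + 2, …`. -/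
theorem decayOp_resolv (ρ : GLAction C L) (hN : N ≤ n) (u : ℂ) (a b : ℕ) :
    DecayOp fun j : ℕ => resolv ρ N (u + j) a b := by
  induction N generalizing a b with
  | zero => exact DecayOp.zero
  | succ N ih =>
    have hZ : DecayOp fun j : ℕ => diagOp C L fun R =>
        rowEval R N (u + j - N) / rowEval R (N + 1) (u + j - N) := by
      refine DecayOp.of_tab fun R hR => ?_
      simp only [diagOp_tab _ hR]
      refine smul_mem_decay ?_ _
      simp only [add_sub_right_comm]
      exact tendsto_rowEval_div_succ hN R (u - N)
    have ih := fun a b => ih (Nat.le_of_succ_le hN) a b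
    simp only [resolv, blockInv]
    refine DecayOp.add ?_ ?_
    · split_ifs
      · exact ih a b
      · exact DecayOp.zero
    · have hW : DecayOp fun j : ℕ => rowMul N (resolv ρ N (u + j)) (fun i => unitOp ρ N i) b :=
        DecayOp.sum fun i _ => (ih i b).const_mul _
      have hV : DecayOp fun j : ℕ => mulCol N (resolv ρ N (u + j)) (fun i => unitOp ρ i N) a :=
        DecayOp.sum fun i _ => (ih a i).mul_const _
      split_ifs
      · exact (hV.mul hZ).mul hW
      · exact (hV.mul hZ).mul_const _
      · exact (hZ.const_mul _).mul hW
      · exact (hZ.const_mul _).mul_const _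

end Level

/-! ### Powers of the matrix of generators and their central traces -/

section Power

variable {A : Type*} [Ring A] {e t : ℕ → ℕ → A} {n N : ℕ} {u : ℂ}

/-- The entries of the powers of the top left `N × N` block of `e`. -/
def blockPow (e : ℕ → ℕ → A) (N : ℕ) : ℕ → ℕ → ℕ → A
  | 0, a, b => if a = b then 1 else 0
  | k + 1, a, b => ∑ l ∈ range N, blockPow e N k a l * e l b

/-- The traces of the powers of the top left `N × N` block of `e`. -/
def blockTrace (e : ℕ → ℕ → A) (N k : ℕ) : A := ∑ a ∈ range N, blockPow e N k a a

theorem commutator_mul (x y z : A) : x * (y * z) - y * z * x =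
    (x * y - y * x) * z + y * (x * z - z * x) := by
  noncomm_ring

/-- Every power of `E` transforms like `E`: in the Leibniz rule the contributions of the summed
index cancel. Taking the trace leaves an invariant. -/
theorem commutator_blockPow (he : GLRel n e) (hN : N ≤ n) (k : ℕ) {i j a b : ℕ} (hi : i < N)
    (hj : j < N) (ha : a < N) (hb : b < N) :
    e i j * blockPow e N k a b - blockPow e N k a b * e i j =
      (if j = a then blockPow e N k i b else 0) - if b = i then blockPow e N k a j else 0 := by
  induction k generalizing a b with
  | zero =>
    have h : e i j * blockPow e N 0 a b - blockPow e N 0 a b * e i j = 0 := by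
      simp only [blockPow]
      split_ifs <;> simp
    rw [h]
    simp only [blockPow]
    split_ifs <;> first | omega | simp
  | succ k ih =>
    simp only [blockPow]
    rw [mul_sum, sum_mul, ← sum_sub_distrib]
    have h : ∀ l ∈ range N, e i j * (blockPow e N k a l * e l b) -
        blockPow e N k a l * e l b * e i j =
        (if j = a then blockPow e N k i l * e l b else 0) -
          (if l = i then blockPow e N k a j * e l b else 0) +
        ((if j = l then blockPow e N k a l * e i b else 0) -
          if b = i then blockPow e N k a l * e l j else 0) := by
      intro l hl
      rw [mem_range] at hl
      rw [commutator_mul, ih ha hl, he i j l b (by omega) (by omega) (by omega) (by omega)]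
      simp only [sub_mul, mul_sub, ite_mul, mul_ite, zero_mul, mul_zero]
    rw [sum_congr rfl h, sum_add_distrib, sum_sub_distrib, sum_sub_distrib, sum_ite_eq,
      sum_ite_eq', if_pos (mem_range.2 hi), if_pos (mem_range.2 hj)]
    split_ifs <;> simp <;> abel

theorem commute_blockTrace (he : GLRel n e) (hN : N ≤ n) (k : ℕ) {i j : ℕ} (hi : i < N)
    (hj : j < N) : e i j * blockTrace e N k = blockTrace e N k * e i j := by
  rw [← sub_eq_zero, blockTrace, mul_sum, sum_mul, ← sum_sub_distrib,
    sum_congr rfl fun a ha => commutator_blockPow he hN k hi hj (mem_range.1 ha) (mem_range.1 ha),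
    sum_sub_distrib, sum_ite_eq, sum_ite_eq', if_pos (mem_range.2 hi), if_pos (mem_range.2 hj),
    sub_self]

theorem map_blockTrace {B : Type*} [Ring B] (f : A →+* B) (e : ℕ → ℕ → A) (N k : ℕ) :
    f (blockTrace e N k) = blockTrace (fun i j => f (e i j)) N k := by
  have h : ∀ a b, f (blockPow e N k a b) = blockPow (fun i j => f (e i j)) N k a b := by
    induction k with
    | zero => intro a b; simp only [blockPow]; split_ifs <;> simp
    | succ k ih => intro a b; simp only [blockPow, map_sum, map_mul, ih]
  simp only [blockTrace, map_sum, h]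

theorem blockTrace_mem [Algebra ℂ A] (S : Subalgebra ℂ A) (h : ∀ i < N, ∀ j < N, e i j ∈ S) (k : ℕ) :
    blockTrace e N k ∈ S := by
  have h : ∀ a < N, ∀ b < N, blockPow e N k a b ∈ S := by
    induction k with
    | zero => intro a _ b _; simp only [blockPow]; split_ifs; exacts [S.one_mem, S.zero_mem]
    | succ k ih =>
      intro a ha b hb
      exact S.sum_mem fun l hl => S.mul_mem (ih a ha l (mem_range.1 hl)) (h l (mem_range.1 hl) b hb)
  exact S.sum_mem fun a ha => h a (mem_range.1 ha) a (mem_range.1 ha)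

/-- The trace of the product of a power of the block and a matrix. -/
def powTrace (e : ℕ → ℕ → A) (N : ℕ) (t : ℕ → ℕ → A) (k : ℕ) : A :=
  ∑ a ∈ range N, ∑ b ∈ range N, blockPow e N k a b * t b a

theorem powTrace_zero (e : ℕ → ℕ → A) (N : ℕ) (t : ℕ → ℕ → A) :
    powTrace e N t 0 = ∑ a ∈ range N, t a a := by
  refine sum_congr rfl fun a ha => ?_
  simp only [blockPow, ite_mul, one_mul, zero_mul]
  rw [sum_ite_eq, if_pos ha]

/-- The relation `E t = u t - 1` under the trace. It replaces the expansion of the resolvent in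
powers of `u⁻¹`. -/
theorem IsResolvent.powTrace_succ [Algebra ℂ A] (h : IsResolvent e N u t) (k : ℕ) :
    powTrace e N t (k + 1) = u • powTrace e N t k - blockTrace e N k := by
  rw [powTrace, powTrace, blockTrace, smul_sum, ← sum_sub_distrib]
  refine sum_congr rfl fun a ha => ?_
  simp only [blockPow, sum_mul, mul_assoc]
  rw [sum_comm]
  simp only [← mul_sum]
  rw [sum_congr rfl fun l hl => by rw [h.left l (mem_range.1 hl) a (mem_range.1 ha)]]
  simp only [mul_sub, sum_sub_distrib, mul_ite, mul_one, mul_zero, smul_sum, mul_smul_comm]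
  rw [sum_ite_eq', if_pos ha]

/-- The traces of the powers of the block of size `N` are central in `U(𝔤𝔩_N)`. -/
theorem blockTrace_mem_centerU {n N : ℕ} (hN : N ≤ n) (k : ℕ) :
    blockTrace (fun i j => UniversalEnvelopingAlgebra.ι ℂ (matUnit n (i + 1) (j + 1))) N k ∈
      centerU n N := by
  constructor
  · refine blockTrace_mem _ (fun i hi j hj => ?_) k
    exact Algebra.subset_adjoin ⟨i + 1, j + 1, by omega, hi, by omega, hj, rfl⟩
  · set x := blockTrace (fun i j => UniversalEnvelopingAlgebra.ι ℂ (matUnit n (i + 1) (j + 1))) N k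
      with hx
    have h : subU n N ≤ Subalgebra.centralizer ℂ {x} := by
      refine Algebra.adjoin_le ?_
      rintro y ⟨i, j, hi, hiN, hj, hjN, rfl⟩
      obtain ⟨i, rfl⟩ : ∃ i', i = i' + 1 := ⟨i - 1, by omega⟩
      obtain ⟨j, rfl⟩ : ∃ j', j = j' + 1 := ⟨j - 1, by omega⟩
      rw [SetLike.mem_coe, Subalgebra.mem_centralizer_iff]
      rintro z rfl
      exact (commute_blockTrace (glRel_lieHom _) hN k hiN hjN).symm
    intro y hy
    exact (Subalgebra.mem_centralizer_iff ℂ).1 (h hy) x rfl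

end Power

/-! ### Eigenvalues of the traces determine the unordered rows -/

section Eigenvalue

variable {n : ℕ} {C : Set (Rel n)} {L R R' : Tableau n} {ρ : GLAction C L} {N k : ℕ} {u : ℂ}

theorem decayOp_powTrace (ρ : GLAction C L) (hN : N ≤ n) (u : ℂ) (k : ℕ) :
    DecayOp fun j : ℕ => powTrace (unitOp ρ) N (resolv ρ N (u + j)) k :=
  DecayOp.sum fun a _ => DecayOp.sum fun b _ => (decayOp_resolv ρ hN u b a).const_mul _

/-- The diagonal entry at `T` of the trace of the `k`-th power of the block of size `N`. -/
noncomputable def traceCoeff (ρ : GLAction C L) (N k : ℕ) (T : tableaux C L) : ℂ :=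
  blockTrace (unitOp ρ) N k (tab C L T) T

theorem tendsto_powTrace (ρ : GLAction C L) (hN : N ≤ n) (u : ℂ) (k : ℕ) (R : Tableau n)
    (T : tableaux C L) :
    Tendsto (fun j : ℕ => powTrace (unitOp ρ) N (resolv ρ N (u + j)) k (tab C L R) T) atTop
      (𝓝 0) :=
  tendsto_of_mem_decay (decayOp_powTrace ρ hN u k (tab C L R)) (Finsupp.lapply T)

theorem powTrace_zero_tab (hC : Admissible C) (hL : IsRealization C L) (hρ : IsGTAction C L ρ)
    (hN : N ≤ n) (hu : Generic L u) (hR : R ∈ tableaux C L) :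
    powTrace (unitOp ρ) N (resolv ρ N u) 0 (tab C L R) =
      (1 - rowEval R N (u - N) / rowEval R N (u - N + 1)) • tab C L R := by
  have h := LinearMap.congr_fun (one_sub_trace_resolv hC hL hρ hN hu) (tab C L R)
  rw [diagOp_tab _ hR, LinearMap.sub_apply, Module.End.one_apply] at h
  rw [powTrace_zero, sub_smul, one_smul, ← h]
  abel

theorem powTrace_succ_apply (hC : Admissible C) (hL : IsRealization C L) (hρ : IsGTAction C L ρ)
    (hN : N ≤ n) (hu : Generic L u) (k : ℕ) (v : TabSpace C L) (T : tableaux C L) :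
    powTrace (unitOp ρ) N (resolv ρ N u) (k + 1) v T =
      u * powTrace (unitOp ρ) N (resolv ρ N u) k v T - blockTrace (unitOp ρ) N k v T := by
  rw [(resolv_spec hC hL hρ hN hu).1.powTrace_succ]
  rfl

/-- The traces of the powers of the blocks are diagonal in the basis of tableaux. -/
theorem blockTrace_tab (hC : Admissible C) (hL : IsRealization C L) (hρ : IsGTAction C L ρ)
    (hN : N ≤ n) (k : ℕ) (T : tableaux C L) :
    blockTrace (unitOp ρ) N k (tab C L T) = traceCoeff ρ N k T • tab C L T := by
  obtain ⟨u, hu⟩ := exists_generic L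
  ext T'
  by_cases hne : T' = T
  · subst hne
    simp [traceCoeff, tab_apply]
  have h0 : tab C L T T' = 0 := by
    rw [tab_apply, if_neg fun h => hne (Subtype.ext h.symm)]
  rw [Finsupp.smul_apply, h0, smul_zero]
  have hk : ∀ k, blockTrace (unitOp ρ) N k (tab C L T) T' = 0 ∧
      ∀ j : ℕ, powTrace (unitOp ρ) N (resolv ρ N (u + j)) k (tab C L T) T' = 0 := by
    intro k
    have key : ∀ k, (∀ j : ℕ, powTrace (unitOp ρ) N (resolv ρ N (u + j)) k (tab C L T) T' = 0) →
        blockTrace (unitOp ρ) N k (tab C L T) T' = 0 := by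
      intro k h
      -- By the recursion this coefficient is minus that of the trace of the power, which does not
      -- depend on `j`; since it also tends to zero, it vanishes.
      have h1 := tendsto_powTrace ρ hN u (k + 1) T T'
      simp only [powTrace_succ_apply hC hL hρ hN (hu.add_nat _), h, mul_zero, zero_sub] at h1
      simpa using tendsto_nhds_unique tendsto_const_nhds h1
    induction k with
    | zero =>
      have h : ∀ j : ℕ, powTrace (unitOp ρ) N (resolv ρ N (u + j)) 0 (tab C L T) T' = 0 := by
        intro j
        rw [powTrace_zero_tab hC hL hρ hN (hu.add_nat j) T.2, Finsupp.smul_apply, h0, smul_zero]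
      exact ⟨key 0 h, h⟩
    | succ k ih =>
      have h : ∀ j : ℕ,
          powTrace (unitOp ρ) N (resolv ρ N (u + j)) (k + 1) (tab C L T) T' = 0 := by
        intro j
        rw [powTrace_succ_apply hC hL hρ hN (hu.add_nat j), ih.1, ih.2, mul_zero, sub_zero]
      exact ⟨key _ h, h⟩
  exact (hk k).1

theorem eq_zero_of_tendsto_eval {P : Polynomial ℂ} {a : ℂ}
    (h : Tendsto (fun j : ℕ => P.eval (a + j)) atTop (𝓝 0)) : P = 0 := by
  have hz : Tendsto (fun j : ℕ => ‖a + (j : ℂ)‖) atTop atTop := by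
    have h1 : Tendsto (fun j : ℕ => (j : ℝ) + -‖a‖) atTop atTop :=
      tendsto_atTop_add_const_right _ _ tendsto_natCast_atTop_atTop
    refine tendsto_atTop_mono (fun j => ?_) h1
    have := norm_sub_norm_le (j : ℂ) (-a)
    rw [Complex.norm_natCast, norm_neg, sub_neg_eq_add, add_comm _ a] at this
    linarith
  by_cases hd : 0 < P.degree
  · exact (not_tendsto_nhds_of_tendsto_atTop (P.tendsto_norm_atTop hd hz) 0 (by simpa using h.norm)).elim
  · rw [Polynomial.eq_C_of_degree_le_zero (not_lt.1 hd)] at h ⊢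
    simp only [Polynomial.eval_C] at h
    rw [tendsto_nhds_unique tendsto_const_nhds h, map_zero]

/-- The monic polynomial with the entries of row `k` as roots. -/
noncomputable def rowPoly (R : Tableau n) (k : ℕ) : Polynomial ℂ :=
  ∏ p ∈ rowSet n k, (Polynomial.X - Polynomial.C (R p))

theorem eval_rowPoly (R : Tableau n) (k : ℕ) (w : ℂ) : (rowPoly R k).eval w = rowEval R k w := by
  simp [rowPoly, rowEval, Polynomial.eval_prod]

/-- The traces of the powers determine the entries of each row up to order. -/
theorem rowPoly_eq (hC : Admissible C) (hL : IsRealization C L) (hρ : IsGTAction C L ρ)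
    (hN : N ≤ n) {T T' : tableaux C L} (h : ∀ k, traceCoeff ρ N k T = traceCoeff ρ N k T') :
    rowPoly (T : Tableau n) N = rowPoly (T' : Tableau n) N := by
  obtain ⟨u, hu⟩ := exists_generic L
  set θ : Tableau n → ℕ → ℂ := fun R j =>
    rowEval R N (u + j - N) / rowEval R N (u + j - N + 1) with hθ
  -- Equal eigenvalues cancel in the recursion, so each step only multiplies the difference by `u +
  -- j`. As all these differences decay, `θ T' - θ T` decays faster than any power.
  have h1 : ∀ k, ∀ j : ℕ, powTrace (unitOp ρ) N (resolv ρ N (u + j)) k (tab C L T) T -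
      powTrace (unitOp ρ) N (resolv ρ N (u + j)) k (tab C L T') T' =
        (u + j) ^ k * (θ T' j - θ T j) := by
    intro k j
    induction k with
    | zero =>
      rw [powTrace_zero_tab hC hL hρ hN (hu.add_nat j) T.2,
        powTrace_zero_tab hC hL hρ hN (hu.add_nat j) T'.2, Finsupp.smul_apply, Finsupp.smul_apply,
        tab_apply, tab_apply, if_pos rfl, if_pos rfl, hθ]
      simp
    | succ k ih =>
      rw [powTrace_succ_apply hC hL hρ hN (hu.add_nat j),
        powTrace_succ_apply hC hL hρ hN (hu.add_nat j)]
      have := h k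
      rw [traceCoeff, traceCoeff] at this
      rw [this]
      linear_combination (u + j) * ih
  have h2 : ∀ k, Tendsto (fun j : ℕ => (u + j) ^ k * (θ T' j - θ T j)) atTop (𝓝 0) := by
    intro k
    simp only [← h1]
    simpa using (tendsto_powTrace ρ hN u k T T).sub (tendsto_powTrace ρ hN u k T' T')
  have h3 : ∀ P : Polynomial ℂ,
      Tendsto (fun j : ℕ => P.eval (u + j) * (θ T' j - θ T j)) atTop (𝓝 0) := by
    intro P
    simp only [Polynomial.eval_eq_sum_range, sum_mul, mul_assoc]
    rw [← sum_const_zero (s := range (P.natDegree + 1))]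
    exact tendsto_finsetSum _ fun k _ => by simpa using (h2 k).const_mul (P.coeff k)
  set A := rowPoly (T : Tableau n) N with hA
  set A' := rowPoly (T' : Tableau n) N with hA'
  have hev : ∀ w, A.eval w = rowEval (T : Tableau n) N w := eval_rowPoly _ _
  have hev' : ∀ w, A'.eval w = rowEval (T' : Tableau n) N w := eval_rowPoly _ _
  have hne : ∀ j : ℕ, A.eval (u - N + j) ≠ 0 := fun j => by
    rw [hev]; exact ((hu.sub_nat N).add_nat j).rowEval_ne_zero T.2 N
  have hne' : ∀ j : ℕ, A'.eval (u - N + j) ≠ 0 := fun j => by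
    rw [hev']; exact ((hu.sub_nat N).add_nat j).rowEval_ne_zero T'.2 N
  set sh : ℂ → Polynomial ℂ := fun c => Polynomial.X + Polynomial.C c with hsh
  have h4 : A'.comp (sh 0) * A.comp (sh 1) - A.comp (sh 0) * A'.comp (sh 1) = 0 := by
    refine eq_zero_of_tendsto_eval (a := u - N) ?_
    -- Evaluated at `u + j`, this polynomial is the product of the two denominators `A (u + j - N +
    -- 1)` and `A' (u + j - N + 1)`, so a polynomial in `j` is left.
    refine (h3 ((A * A').comp (sh (1 - N)))).congr fun j => ?_
    have e2 : u + j - N = u - N + j := by ring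
    have e3 : u + j + (1 - N) = u - N + (j + 1 : ℕ) := by push_cast; ring
    have e4 : u - N + j + 1 = u - N + (j + 1 : ℕ) := by push_cast; ring
    simp only [hsh, Polynomial.eval_comp, Polynomial.eval_add, Polynomial.eval_X,
      Polynomial.eval_C, Polynomial.eval_mul, Polynomial.eval_sub, hθ, ← hev, ← hev', e2, e3,
      add_zero, e4]
    have := hne (j + 1)
    have := hne' (j + 1)
    field_simp
  -- By `h4` the quotient `A / A'` is unchanged under a unit shift; its limit is `1` because both
  -- polynomials are monic of the same degree.
  have h5 : ∀ j : ℕ, A.eval (u - N + j) / A'.eval (u - N + j) = A.eval (u - N) / A'.eval (u - N) := by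
    intro j
    induction j with
    | zero => simp
    | succ j ih =>
      rw [← ih, div_eq_div_iff (hne' _) (hne' _)]
      have h6 := congrArg (Polynomial.eval (u - N + j)) h4
      have e4 : u - N + j + 1 = u - N + (j + 1 : ℕ) := by push_cast; ring
      simp only [hsh, Polynomial.eval_comp, Polynomial.eval_add, Polynomial.eval_X,
        Polynomial.eval_C, Polynomial.eval_mul, Polynomial.eval_sub, add_zero, e4,
        Polynomial.eval_zero] at h6
      linear_combination h6
  have h7 : A.eval (u - N) / A'.eval (u - N) = 1 := by
    have h8 := tendsto_rowEval_div hN (T : Tableau n) T' (u - N) (u - N)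
    simp only [← hev, ← hev', h5] at h8
    exact tendsto_nhds_unique tendsto_const_nhds h8
  rw [← sub_eq_zero]
  refine eq_zero_of_tendsto_eval (a := u - N) ?_
  refine tendsto_const_nhds.congr fun j => ?_
  have := (div_eq_one_iff_eq (hne' j)).1 ((h5 j).trans h7)
  rw [Polynomial.eval_sub, this, sub_self]

end Eigenvalue

open Polynomial

/-! ### Unordered rows determine the tableau -/

section Separation

variable {n : ℕ} {C : Set (Rel n)} {L R R' : Tableau n} {ρ : GLAction C L} {N k : ℕ}

theorem roots_rowPoly (R : Tableau n) (k : ℕ) : (rowPoly R k).roots = (rowSet n k).val.map R := by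
  rw [← roots_multiset_prod_X_sub_C ((rowSet n k).val.map R), Multiset.map_map]
  rfl

open Classical in
theorem card_filter_eq_of_rowPoly_eq (h : rowPoly R k = rowPoly R' k) (S : ℂ → Prop) :
    #{p ∈ rowSet n k | S (R p)} = #{p ∈ rowSet n k | S (R' p)} := by
  have h1 := congrArg (Multiset.countP S) (congrArg roots h)
  rwa [roots_rowPoly, roots_rowPoly, Multiset.countP_map, Multiset.countP_map] at h1

/-- The left side depends on `C` alone, so the integral order pattern inside a row is the same in
all realizations. -/
theorem IsRealization.dominates_iff (hC : Admissible C) (hR : IsRealization C R) {p q : Pos n}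
    (hpq : p.row = q.row) (hp : p.row < n) : Dominates C p q ↔ ∃ m : ℕ, R p - R q = m := by
  refine ⟨fun h => h.sub_nonneg hR.1, fun ⟨m, hm⟩ => ?_⟩
  by_cases hne : p = q
  · subst hne
    exact .refl
  · exact hR.dominates hC hpq.symm (hpq ▸ hp) hm hne

-- Counting argument: equally many entries of `R` lie at nonnegative integral distance below `R p`
-- and below `R' p`, by the common order pattern and the equality of the unordered rows. As `R' p`
-- is the lower bound, one set contains the other, so they agree. The set for `R p` contains `p`,
-- hence `R p` is also at most `R' p`.
open Classical in
theorem apply_le_of_rowPoly_eq (hC : Admissible C) (hR : IsRealization C R)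
    (hR' : IsRealization C R') {p : Pos n} (hp : p.row < n)
    (h : rowPoly R p.row = rowPoly R' p.row) {m : ℕ} (hm : R p - R' p = m) : R p = R' p := by
  have h1 : #{q ∈ rowSet n p.row | ∃ m : ℕ, R p - R q = m} =
      #{q ∈ rowSet n p.row | ∃ m : ℕ, R' p - R q = m} := by
    rw [card_filter_eq_of_rowPoly_eq h fun x => ∃ m : ℕ, R' p - x = m]
    congr 1
    refine filter_congr fun q hq => ?_
    have hq := (mem_rowSet.1 hq).symm
    rw [← hR.dominates_iff hC hq hp, ← hR'.dominates_iff hC hq hp]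
  have h2 : {q ∈ rowSet n p.row | ∃ m : ℕ, R' p - R q = m} ⊆
      {q ∈ rowSet n p.row | ∃ m : ℕ, R p - R q = m} := by
    refine monotone_filter_right _ fun q _ hq => ?_
    obtain ⟨k, hk⟩ := hq
    refine ⟨m + k, ?_⟩
    push_cast
    rw [← hm, ← hk]
    ring
  have h3 : p ∈ {q ∈ rowSet n p.row | ∃ m : ℕ, R' p - R q = m} := by
    rw [eq_of_subset_of_card_le h2 h1.le]
    exact mem_filter.2 ⟨mem_rowSet.2 rfl, 0, by simp⟩
  obtain ⟨k, hk⟩ := (mem_filter.1 h3).2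
  have h4 : ((m + k : ℕ) : ℂ) = 0 := by
    push_cast
    rw [← hm, ← hk]
    ring
  have h5 : m = 0 := by
    have := Nat.cast_eq_zero.1 h4
    omega
  rw [h5, Nat.cast_zero, sub_eq_zero] at hm
  exact hm

/-- A tableau is determined by the unordered rows below the top row. -/
theorem eq_of_rowPoly_eq (hC : Admissible C) (hL : IsRealization C L) (hR : R ∈ tableaux C L)
    (hR' : R' ∈ tableaux C L) (h : ∀ k < n, rowPoly R k = rowPoly R' k) : R = R' := by
  have hre := hL.of_intShift (intShift_of_mem hR) hR.2
  have hre' := hL.of_intShift (intShift_of_mem hR') hR'.2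
  obtain ⟨⟨z, hz, hz'⟩, -⟩ := hR
  obtain ⟨⟨w, hw, hw'⟩, -⟩ := hR'
  ext p
  have hp : p.row ≤ n := p.1.2
  rcases hp.lt_or_eq with hp | hp
  · rcases le_total (w p) (z p) with hle | hle
    · obtain ⟨m, hm⟩ := Int.eq_ofNat_of_zero_le (sub_nonneg.2 hle)
      refine apply_le_of_rowPoly_eq (m := m) hC hre hre' hp (h _ hp) ?_
      have : ((z p - w p : ℤ) : ℂ) = ((m : ℤ) : ℂ) := by rw [hm]
      push_cast at this
      rw [hz', hw', ← this]
      ring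
    · obtain ⟨m, hm⟩ := Int.eq_ofNat_of_zero_le (sub_nonneg.2 hle)
      refine (apply_le_of_rowPoly_eq (m := m) hC hre' hre hp (h _ hp).symm ?_).symm
      have : ((w p - z p : ℤ) : ℂ) = ((m : ℤ) : ℂ) := by rw [hm]
      push_cast at this
      rw [hz', hw', ← this]
      ring
  · rw [hz', hw', hz p hp, hw p hp]

end Separation

/-! ### Diagonal action of the Gelfand-Tsetlin subalgebra and multiplicity one -/

section Multiplicity

variable {n : ℕ} {C : Set (Rel n)} {L : Tableau n} {ρ : GLAction C L}

/-- The action of the Gelfand-Tsetlin subalgebra. -/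
noncomputable def gamAct (ρ : GLAction C L) : Gam n →ₐ[ℂ] Module.End ℂ (TabSpace C L) :=
  (UniversalEnvelopingAlgebra.lift ℂ ρ).comp (Gam n).val

theorem exists_gamAct_eq_blockTrace (ρ : GLAction C L) {N : ℕ} (h1 : 1 ≤ N) (hN : N ≤ n) (k : ℕ) :
    ∃ x, gamAct ρ x = blockTrace (unitOp ρ) N k := by
  refine ⟨⟨_, Algebra.subset_adjoin ⟨N, h1, hN, blockTrace_mem_centerU hN k⟩⟩, ?_⟩
  refine (map_blockTrace (UniversalEnvelopingAlgebra.lift ℂ ρ).toRingHom _ N k).trans ?_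
  congr 1
  ext i j : 2
  exact UniversalEnvelopingAlgebra.lift_ι_apply ℂ ρ _

theorem traceCoeff_injective (hC : Admissible C) (hL : IsRealization C L) (hρ : IsGTAction C L ρ)
    {T T' : tableaux C L} (h : ∀ N, 1 ≤ N → N ≤ n → ∀ k, traceCoeff ρ N k T = traceCoeff ρ N k T') :
    T = T' := by
  refine Subtype.ext (eq_of_rowPoly_eq hC hL T.2 T'.2 fun k hk => ?_)
  rcases Nat.eq_zero_or_pos k with rfl | hpos
  · simp [rowPoly, rowSet_zero]
  · exact rowPoly_eq hC hL hρ hk.le (h k hpos hk.le)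

theorem blockTrace_apply (hC : Admissible C) (hL : IsRealization C L) (hρ : IsGTAction C L ρ)
    {N : ℕ} (hN : N ≤ n) (k : ℕ) (v : TabSpace C L) (T : tableaux C L) :
    blockTrace (unitOp ρ) N k v T = traceCoeff ρ N k T * v T := by
  classical
  have h : Finsupp.lapply T ∘ₗ blockTrace (unitOp ρ) N k =
      traceCoeff ρ N k T • Finsupp.lapply T := by
    refine ext_tab fun R hR => ?_
    have h1 := blockTrace_tab hC hL hρ hN k ⟨R, hR⟩
    simp only [LinearMap.comp_apply, LinearMap.smul_apply, Finsupp.lapply_apply, h1,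
      Finsupp.smul_apply, tab_apply]
    split_ifs with h2
    · subst h2
      rfl
    · simp
  exact LinearMap.congr_fun h v

/-- The character by which the Gelfand-Tsetlin subalgebra acts on a tableau. -/
noncomputable def gamChar (ρ : GLAction C L) (T : tableaux C L) (x : Gam n) : ℂ :=
  gamAct ρ x (tab C L T) T

/-- `Γ` is commutative and contains the traces, whose joint eigenvalues separate tableaux. An
operator commuting with them has no off-diagonal coefficients. -/
theorem gamAct_tab (hC : Admissible C) (hL : IsRealization C L) (hρ : IsGTAction C L ρ)
    (T : tableaux C L) (x : Gam n) : gamAct ρ x (tab C L T) = gamChar ρ T x • tab C L T := by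
  classical
  ext T'
  rw [Finsupp.smul_apply, tab_apply]
  split_ifs with h
  · rw [← Subtype.ext h, gamChar, smul_eq_mul, mul_one]
  · rw [smul_zero]
    by_contra hne
    refine h (congrArg Subtype.val (traceCoeff_injective hC hL hρ fun N h1 hN k => ?_))
    obtain ⟨y, hy⟩ := exists_gamAct_eq_blockTrace ρ h1 hN k
    have h2 : gamAct ρ y * gamAct ρ x = gamAct ρ x * gamAct ρ y := by
      rw [← map_mul, ← map_mul, (instIsMulCommutativeGam n).is_comm.comm y x]
    rw [hy] at h2
    have h3 := DFunLike.congr_fun (LinearMap.congr_fun h2 (tab C L T)) T'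
    rw [Module.End.mul_apply, Module.End.mul_apply, blockTrace_apply hC hL hρ hN,
      blockTrace_tab hC hL hρ hN, map_smul, Finsupp.smul_apply, smul_eq_mul] at h3
    exact (mul_right_cancel₀ hne h3).symm

theorem gamAct_apply (hC : Admissible C) (hL : IsRealization C L) (hρ : IsGTAction C L ρ)
    (v : TabSpace C L) (T : tableaux C L) (x : Gam n) : gamAct ρ x v T = gamChar ρ T x * v T := by
  classical
  have h : Finsupp.lapply T ∘ₗ gamAct ρ x = gamChar ρ T x • Finsupp.lapply T := by
    refine ext_tab fun R hR => ?_
    have h1 := gamAct_tab hC hL hρ ⟨R, hR⟩ x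
    simp only [LinearMap.comp_apply, LinearMap.smul_apply, Finsupp.lapply_apply, h1,
      Finsupp.smul_apply, tab_apply]
    split_ifs with h2
    · subst h2
      rfl
    · simp
  exact LinearMap.congr_fun h v

theorem gamChar_injective (hC : Admissible C) (hL : IsRealization C L) (hρ : IsGTAction C L ρ) :
    Function.Injective (gamChar ρ) := by
  intro T T' h
  refine traceCoeff_injective hC hL hρ fun N h1 hN k => ?_
  obtain ⟨y, hy⟩ := exists_gamAct_eq_blockTrace ρ h1 hN k
  have := congrFun h y
  rwa [gamChar, gamChar, hy] at this

/-- The character of a tableau, as a homomorphism of algebras. -/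
noncomputable def gamHom (hC : Admissible C) (hL : IsRealization C L) (hρ : IsGTAction C L ρ)
    (T : tableaux C L) : Gam n →+* ℂ where
  toFun := gamChar ρ T
  map_one' := by simp [gamChar, tab_apply]
  map_zero' := by simp [gamChar]
  map_add' x y := by simp [gamChar]
  map_mul' x y := by
    rw [gamChar, map_mul, Module.End.mul_apply, gamAct_apply hC hL hρ, gamChar, gamChar]

theorem mem_gtSpace_iff {𝔪 : Ideal (Gam n)} {v : TabSpace C L} :
    v ∈ gtSpace ρ 𝔪 ↔ ∃ k : ℕ, ∀ x ∈ 𝔪 ^ k, gamAct ρ x v = 0 := Iff.rfl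

/-- If `x ∈ 𝔪`, then `x ^ k` acts on the coordinate at `T` by the `k`-th power of the character,
which must vanish. -/
theorem le_ker_of_mem_gtSpace (hC : Admissible C) (hL : IsRealization C L)
    (hρ : IsGTAction C L ρ) {𝔪 : Ideal (Gam n)} {v : TabSpace C L} (hv : v ∈ gtSpace ρ 𝔪)
    {T : tableaux C L} (hT : v T ≠ 0) : 𝔪 ≤ RingHom.ker (gamHom hC hL hρ T) := by
  obtain ⟨k, hk⟩ := mem_gtSpace_iff.1 hv
  intro x hx
  have h1 := DFunLike.congr_fun (hk (x ^ k) (Ideal.pow_mem_pow hx k)) T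
  rw [gamAct_apply hC hL hρ, Finsupp.zero_apply, mul_eq_zero, or_iff_left hT] at h1
  have h2 : gamHom hC hL hρ T x ^ k = 0 := by
    rw [← map_pow]
    exact h1
  exact RingHom.mem_ker.2 (eq_zero_of_pow_eq_zero h2)

theorem finrank_gtSpace (hC : Admissible C) (hL : IsRealization C L) (hρ : IsGTAction C L ρ)
    {𝔪 : Ideal (Gam n)} (h𝔪 : 𝔪 ∈ gtSupport ρ) : Module.finrank ℂ (gtSpace ρ 𝔪) = 1 := by
  obtain ⟨hmax, hne⟩ := h𝔪
  obtain ⟨v, hv, hv0⟩ := Submodule.exists_mem_ne_zero_of_ne_bot hne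
  have hker : ∀ w ∈ gtSpace ρ 𝔪, ∀ T, w T ≠ 0 → 𝔪 = RingHom.ker (gamHom hC hL hρ T) :=
    fun w hw T hT => hmax.eq_of_le (RingHom.ker_ne_top _) (le_ker_of_mem_gtSpace hC hL hρ hw hT)
  obtain ⟨T, hT⟩ : ∃ T, v T ≠ 0 := by
    by_contra! h
    exact hv0 (Finsupp.ext h)
  have hsingle : ∀ w ∈ gtSpace ρ 𝔪, ∀ T', w T' ≠ 0 → T' = T := by
    intro w hw T' hT'
    refine gamChar_injective hC hL hρ (funext fun x => ?_)
    have h1 := (hker w hw T' hT').symm.trans (hker v hv T hT)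
    -- Characters of a `ℂ`-algebra with the same kernel are equal: `x` minus its value under one of
    -- them lies in both kernels.
    have h2 : x - algebraMap ℂ (Gam n) (gamChar ρ T x) ∈ RingHom.ker (gamHom hC hL hρ T) := by
      rw [RingHom.mem_ker]
      change gamChar ρ T _ = 0
      simp [gamChar, tab_apply]
    rw [← h1, RingHom.mem_ker] at h2
    change gamChar ρ T' _ = 0 at h2
    simpa [gamChar, tab_apply, sub_eq_zero] using h2
  refine (finrank_eq_one_iff_of_nonzero' (V := gtSpace ρ 𝔪) ⟨v, hv⟩
    fun h => hv0 (congrArg Subtype.val h)).2 fun w => ?_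
  refine ⟨w.1 T / v T, Subtype.ext (Finsupp.ext fun T' => ?_)⟩
  by_cases h : T' = T
  · subst h
    exact div_mul_cancel₀ _ hT
  · have h1 : v T' = 0 := by_contra fun h' => h (hsingle v hv T' h')
    have h2 : w.1 T' = 0 := by_contra fun h' => h (hsingle w.1 w.2 T' h')
    change w.1 T / v T * v T' = w.1 T'
    rw [h1, h2, mul_zero]

end Multiplicity
end GelfandTsetlin

theorem mainTheorem6 (n : ℕ) (hn : 2 ≤ n) (C : Set (GelfandTsetlin.Rel n))
    (hC : GelfandTsetlin.Admissible C) (L : GelfandTsetlin.Tableau n)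
    (hL : GelfandTsetlin.IsRealization C L) (ρ : GelfandTsetlin.GLAction C L)
    (hρ : GelfandTsetlin.IsGTAction C L ρ) :
    ∀ 𝔪 ∈ GelfandTsetlin.gtSupport ρ, Module.finrank ℂ (GelfandTsetlin.gtSpace ρ 𝔪) = 1 :=
  fun _ h𝔪 => GelfandTsetlin.finrank_gtSpace hC hL hρ h𝔪
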